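/- **Setting.** Let $n\ge 2$, $m\ge1$, $V=\{1,\dots,n\}$, let $(V,E)$ be a simple undirected graph and let $P\in\mathbb R^{n\times n}$ be a doubly stochastic matrix supported on it: for $v\ne w$, $P_{vw}\neq 0$ only if $\{v,w\}\in E$. Let $\sigma_2(P)$ be either of the following two quantities (they agree when both are defined): * if $P$ is normal, $PP^\top=P^\top P$ (for instance symmetric): the second largest absolute value of an eigenvalue of $P$, counted with multiplicity; * for arbitrary $P$: the second largest singular value of $P$, counted with multiplicity; and assume $\sigma_2(P)<1$. Let $\mathcal Z$ be a measurable space, $\ell:\mathbb R^d\times\mathcal Z\to\mathbb R$ a loss function that is measurable in $z$, and let $\partial\ell(x,z)$ be a jointly measurable choice of a subgradient of $\ell(\cdot,z)$ at $x$. The data $Z_{v,i}$ ($v\in V$, $1\le i\le m$) are i.i.d. with the law of $Z$; the test risk is $r(x)=\mathbf E\,\ell(x,Z)$, with a minimiser $x^\star$, and the empirical risk is $R(x)=\frac1{nm}\sum_{v,i}\ell(x,Z_{v,i})$; assume that almost surely $R$ has a minimiser $X^\star$ with $\|X^\star\|\le G$, where $\|\cdot\|$ is the $\ell_2$ norm and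 $G$ is a constant. The indices $K^s_v$ ($v\in V$, $s\ge2$) are uniform on $\{1,\dots,m\}$, and the vectors $(K^s_v)_{v\in V}$, $s\ge 2$, are independent of each other and of the data. Distributed SGD with step size $\eta$ started at $0$ is defined by $X^1_v=0$ and $$X^{s+1}_v=\sum_{w\in V}P_{vw}\bigl(X^s_w-\eta\,\partial\ell(X^s_w,Z_{w,K^{s+1}_w})\bigr),\qquad s\ge1 .$$ **Theorem (Test Error bounds for convex and Lipschitz losses).** Assume that for every $z\in\mathcal Z$ the function $\ell(\cdot,z)$ is convex and $L$-Lipschitz with respect to $\|\cdot\|$. Assume that there are constants $C\le B$ and $D\ge0$ such that * (a) $\ell(0,z)\le B$ and $\ell(x,z)\ge C$ for all $z\in\mathcal Z$ and $x\in\mathbb R^d$; * (b) for all $z_1,\dots,z_{nm}\in\mathcal Z$ and every non-empty bounded $\widetilde{\mathcal X}\subseteq\mathbb R^d$, $$\mathbf E\sup_{x\in\widetilde{\mathcal X}}\frac1{nm}\sum_{i=1}^{nm}\sigma_i\,\ell(x,z_i)\le D\,\frac{\sup_{x\in\widetilde{\mathcal X}}\|x\|}{\sqrt{nm}},$$ where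 the $\sigma_i$ are independent with $\mathbf P(\sigma_i=1)=\mathbf P(\sigma_i=-1)=\frac12$. Then for every $\eta>0$, every $v\in V$ and every integer $t\ge1$, the random variable $r\bigl(\frac1t\sum_{s=1}^tX^s_v\bigr)$ is integrable and $$\mathbf E\,r\Bigl(\frac1t\sum_{s=1}^tX^s_v\Bigr)-r(x^\star)\le 2D\sqrt{\frac{(t-1)(\eta^2L^2+2\eta(B-C))}{nm}}+\frac{19}{2}\,\frac{\eta L^2\log(t\sqrt n)}{1-\sigma_2(P)}+\frac{G^2}{2\eta t}.$$ -/

import Mathlib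

open MeasureTheory ProbabilityTheory

namespace DistSGD

noncomputable section

/-- The model space `ℝ^d` with the `ℓ₂` norm. -/
abbrev Model (d : ℕ) : Type := EuclideanSpace ℝ (Fin d)

/-- `u` is a subgradient of `f` at `x`. -/
def IsSubgradientAt {d : ℕ} (f : Model d → ℝ) (u x : Model d) : Prop :=
  ∀ y, f x + inner ℝ u (y - x) ≤ f y

/-- Test risk `r(x) = E ℓ(x, Z)`, where `Z` has law `ν`. -/
def testRisk {d : ℕ} {𝓩 : Type*} [MeasurableSpace 𝓩] (ℓ : Model d → 𝓩 → ℝ) (ν : Measure 𝓩)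
    (x : Model d) : ℝ :=
  ∫ z, ℓ x z ∂ν

/-- Global empirical risk `R(x) = (nm)⁻¹ ∑_v ∑_i ℓ(x, z_{v,i})` of the dataset `z`. -/
def empiricalRisk {d n m : ℕ} {𝓩 : Type*} (ℓ : Model d → 𝓩 → ℝ) (z : Fin n × Fin m → 𝓩)
    (x : Model d) : ℝ :=
  ((n : ℝ) * m)⁻¹ * ∑ p, ℓ x (z p)

/-- The Distributed SGD iterates for a fixed dataset `z` and fixed sampled indices `k`, started at
`x₁`. The index is shifted by one: `iterate … s v` is the vector `X^{s+1}_v`, and `k s w` is the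
index `K^{s+2}_w` that node `w` uses to pass from `X^{s+1}` to `X^{s+2}`. Here `g x z` is the chosen
subgradient of `ℓ(·, z)` at `x`. -/
def iterate {d n m : ℕ} {𝓩 : Type*} (P : Matrix (Fin n) (Fin n) ℝ) (η : ℝ)
    (g : Model d → 𝓩 → Model d) (x₁ : Fin n → Model d) (z : Fin n × Fin m → 𝓩)
    (k : ℕ → Fin n → Fin m) : ℕ → Fin n → Model d
  | 0, v => x₁ v
  | s + 1, v => ∑ w, P v w •
      (iterate P η g x₁ z k s w - η • g (iterate P η g x₁ z k s w) (z (w, k s w)))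

/-- Ergodic average `(1/t) ∑_{s=1}^t X^s_v`. -/
def ergodicAverage {d n m : ℕ} {𝓩 : Type*} (P : Matrix (Fin n) (Fin n) ℝ) (η : ℝ)
    (g : Model d → 𝓩 → Model d) (x₁ : Fin n → Model d) (z : Fin n × Fin m → 𝓩)
    (k : ℕ → Fin n → Fin m) (t : ℕ) (v : Fin n) : Model d :=
  (t : ℝ)⁻¹ • ∑ s ∈ Finset.range t, iterate P η g x₁ z k s v

/-- `E sup_{x ∈ S} (1/N) ∑_i σ_i ℓ(x, z_i)` for `N` points `z_i` and independent Rademacher signs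
`σ_i`, i.e. for a uniformly distributed vector of signs. -/
def rademacherAverage {d : ℕ} {𝓩 ι : Type*} [Fintype ι] [DecidableEq ι] (ℓ : Model d → 𝓩 → ℝ)
    (z : ι → 𝓩) (S : Set (Model d)) : ℝ :=
  (Fintype.card (ι → ℤˣ) : ℝ)⁻¹ * ∑ σ : ι → ℤˣ,
    ⨆ x : S, (Fintype.card ι : ℝ)⁻¹ * ∑ i, ((σ i : ℤ) : ℝ) * ℓ x (z i)

/-- The Rademacher complexity condition with constant `D` for `nm` points. Sets that are empty
(no supremum) or unbounded (infinite right-hand side) carry no information and are left out. -/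
def RademacherBound {d : ℕ} {𝓩 : Type*} (ℓ : Model d → 𝓩 → ℝ) (n m : ℕ) (D : ℝ) : Prop :=
  ∀ (z : Fin n × Fin m → 𝓩) (S : Set (Model d)), S.Nonempty → Bornology.IsBounded S →
    rademacherAverage ℓ z S ≤ D * (⨆ x : S, ‖(x : Model d)‖) / √((n : ℝ) * m)

/-- Second largest absolute value of an eigenvalue: the absolute values of all complex eigenvalues,
with algebraic multiplicity, are listed in decreasing order and the second entry is taken. -/
def secondEigenvalue {n : ℕ} (P : Matrix (Fin n) (Fin n) ℝ) : ℝ :=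
  (((P.map (algebraMap ℝ ℂ)).charpoly.roots.map fun z => ‖z‖).sort (· ≥ ·)).getD 1 0

/-- Second largest singular value, with multiplicity (`LinearMap.singularValues` is decreasing and
counts from `0`). -/
def secondSingularValue {n : ℕ} (P : Matrix (Fin n) (Fin n) ℝ) : ℝ :=
  (Matrix.toEuclideanLin P).singularValues 1

end

end DistSGD

/-!
The excess test risk of the output `x̂` (the ergodic average at node `v`) is split as
`r(x̂) - r(x⋆) = (r(x̂) - R(x̂)) + (R(x̂) - r(x⋆))`.

*Generalization.* Convexity and `C ≤ ℓ`, `ℓ(0, ·) ≤ B` give `-⟪∂ℓ(x, z), x⟫ ≤ B - C`. Hence each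
step increases the squared norm of the iterates by at most `η² L² + 2 η (B - C)`, and the output
lies in the ball of radius `ρ = √((t - 1) (η² L² + 2 η (B - C)))` whatever the data and the indices
are (`norm_ergodicAverage_le`). The expectation of `r - R` at the output is at most the expected
supremum of `r - R` over this ball. By symmetrization this is at most twice the Rademacher average
(`integral_iSup_sub_average_le`), that is `2 D ρ / √(nm)`. The supremum is taken over a countable
dense subset of the ball, which the continuity of the loss permits and which makes it measurable.

*Optimization.* For a fixed dataset, the mean of the iterates over the nodes performs subgradient
descent with subgradients taken at the iterates of the nodes. As the next index of a node is
uniform given the past (`integral_apply_index`), the standard descent argument bounds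
`E R(x̂) - R(x)`, for every `x`, by `‖x‖² / (2 η t) + η L² / 2 + 3 L δ`, where `δ` bounds the
distance of the iterates to their mean (`integral_empiricalRisk_ergodicAverage_le`). This is used
with `x = X⋆(ω)` for each `ω` separately, so that `X⋆` need not be measurable. Then
`R(X⋆) ≤ R(x⋆)`, and `R(x⋆)` has expectation `r(x⋆)`.

*Consensus.* The distance to the mean is at most `η L ∑ₖ ∑_w |(Pᵏ)_{vw} - 1/n|`
(`norm_iterate_sub_meanIterate_le`). Each inner sum is at most `2`, and also at most `√n σ₂ᵏ`
because `P` contracts vectors of mean zero by the factor `σ₂`. For singular values this holds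
since `1` spans the top singular direction (`contractsMeanZero_secondSingularValue`). For the
eigenvalues of a normal `P` it holds since `P - J`, where `J` has all entries `1/n`, is normal with
spectral radius at most `σ₂` (`contractsMeanZero_secondEigenvalue`). Summation gives
`2 log(t √n) / (1 - σ₂) + 1` (`sum_rowDist_pow_le`), and the additive constants are absorbed in
the factor `19 / 2` (`consensus_constant_le`).
-/

namespace DistSGD

/-! ### Spectral gap of the gossip matrix -/

/-- `P` contracts the vectors of mean zero by the factor `σ` in the Euclidean norm. -/
def ContractsMeanZero {n : ℕ} (P : Matrix (Fin n) (Fin n) ℝ) (σ : ℝ) : Prop :=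
  ∀ x : Fin n → ℝ, ∑ i, x i = 0 → ∑ i, (P.mulVec x i) ^ 2 ≤ σ ^ 2 * ∑ i, x i ^ 2

/-- As `σ₁ < 1`, the vector `1`, which `Pᵀ P` fixes, is orthogonal to every singular vector
except the first, so that all vectors orthogonal to `1` only see the singular values from
`σ₁` on. -/
theorem contractsMeanZero_secondSingularValue {n : ℕ} (hn : 2 ≤ n)
    {P : Matrix (Fin n) (Fin n) ℝ} (hP : P ∈ doublyStochastic ℝ (Fin n))
    (h1 : secondSingularValue P < 1) : ContractsMeanZero P (secondSingularValue P) := by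
  have hn0 : 0 < n := by omega
  intro x hx
  set T := Matrix.toEuclideanLin P with hT
  have hfr : Module.finrank ℝ (EuclideanSpace ℝ (Fin n)) = n := by simp
  set S := T.isSymmetric_adjoint_comp_self
  set b := S.eigenvectorBasis hfr with hb
  set X : EuclideanSpace ℝ (Fin n) := WithLp.toLp 2 x
  set e : EuclideanSpace ℝ (Fin n) := WithLp.toLp 2 (fun _ => (1 : ℝ)) with he
  have hev : ∀ i, S.eigenvalues hfr i = T.singularValues i ^ 2 := fun i =>
    (T.sq_singularValues_fin hfr i).symm
  have hTT : ∀ i, (LinearMap.adjoint T ∘ₗ T) (b i) = (T.singularValues i ^ 2 : ℝ) • b i := by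
    intro i
    have := S.apply_eigenvectorBasis hfr i
    rw [hev] at this
    exact this
  have hTe : T e = e := by
    have := mulVec_one_of_mem_doublyStochastic hP
    simp only [hT, he, Matrix.toLpLin_toLp]
    congr 1
  have hTe' : LinearMap.adjoint T e = e := by
    have h2 := one_vecMul_of_mem_doublyStochastic hP
    have : LinearMap.adjoint T = Matrix.toEuclideanLin P.conjTranspose := by
      rw [Matrix.toEuclideanLin_conjTranspose_eq_adjoint]
    rw [this]
    simp only [he, Matrix.toLpLin_toLp]
    congr 1
    rw [Matrix.toLin'_apply, Matrix.conjTranspose_eq_transpose_of_trivial, Matrix.mulVec_transpose]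
    exact h2
  have hbe : ∀ i : Fin n, 1 ≤ (i : ℕ) → inner ℝ (b i) e = 0 := by
    intro i hi
    have h3 : inner ℝ ((LinearMap.adjoint T ∘ₗ T) (b i)) e = inner ℝ (b i) e := by
      rw [LinearMap.comp_apply, LinearMap.adjoint_inner_left, hTe,
        ← LinearMap.adjoint_inner_right, hTe']
    rw [hTT, real_inner_smul_left] at h3
    have h4 : T.singularValues i ^ 2 < 1 := by
      have h5 : T.singularValues i < 1 := (T.singularValues_antitone hi).trans_lt h1
      have := T.singularValues_nonneg i
      nlinarith
    have : (1 - T.singularValues i ^ 2) * inner ℝ (b i) e = 0 := by linarith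
    rcases mul_eq_zero.1 this with h | h
    · linarith
    · exact h
  have he0 : e = (inner ℝ (b ⟨0, hn0⟩) e : ℝ) • b ⟨0, hn0⟩ := by
    conv_lhs => rw [← b.sum_repr' e]
    rw [Finset.sum_eq_single ⟨0, hn0⟩]
    · intro i _ hi
      rw [hbe i, zero_smul]
      rcases Nat.eq_zero_or_pos i with h | h
      · exact absurd (Fin.ext h) hi
      · exact h
    · simp
  have hc : inner ℝ (b ⟨0, hn0⟩) e ≠ 0 := by
    intro h
    rw [h, zero_smul] at he0
    have : e ⟨0, hn0⟩ = 1 := rfl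
    rw [he0] at this
    simp at this
  have hXe : inner ℝ e X = 0 := by
    rw [PiLp.inner_apply]
    simpa [e, X] using hx
  have hbX : inner ℝ (b ⟨0, hn0⟩) X = 0 := by
    rw [he0, real_inner_smul_left] at hXe
    exact (mul_eq_zero.1 hXe).resolve_left hc
  have hTX : ‖T X‖ ^ 2 = ∑ i : Fin n, T.singularValues i ^ 2 * (inner ℝ (b i) X) ^ 2 := by
    rw [← real_inner_self_eq_norm_sq, ← LinearMap.adjoint_inner_left]
    rw [← b.sum_inner_mul_inner]
    refine Finset.sum_congr rfl fun i _ => ?_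
    have : inner ℝ ((LinearMap.adjoint T) (T X)) (b i) =
        T.singularValues i ^ 2 * inner ℝ (b i) X := by
      rw [LinearMap.adjoint_inner_left, ← LinearMap.adjoint_inner_right,
        ← LinearMap.comp_apply, hTT, real_inner_smul_right, real_inner_comm]
    rw [this]; ring
  have hle : ‖T X‖ ^ 2 ≤ secondSingularValue P ^ 2 * ‖X‖ ^ 2 := by
    have : ‖X‖ ^ 2 = ∑ i, (inner ℝ (b i) X) ^ 2 := by
      rw [← real_inner_self_eq_norm_sq, ← b.sum_inner_mul_inner]
      refine Finset.sum_congr rfl fun i _ => ?_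
      rw [real_inner_comm, sq]
    rw [hTX, this, Finset.mul_sum]
    refine Finset.sum_le_sum fun i _ => ?_
    rcases Nat.eq_zero_or_pos i with h | h
    · have : i = ⟨0, hn0⟩ := Fin.ext h
      rw [this, hbX]; simp
    · refine mul_le_mul_of_nonneg_right ?_ (sq_nonneg _)
      exact pow_le_pow_left₀ (T.singularValues_nonneg _) (T.singularValues_antitone h) 2
  rw [EuclideanSpace.real_norm_sq_eq, EuclideanSpace.real_norm_sq_eq] at hle
  exact hle

/-- The averaging matrix, all of whose entries are `1 / n`. -/
noncomputable def avgMatrix (R : Type*) [Field R] (n : ℕ) : Matrix (Fin n) (Fin n) R :=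
  Matrix.of fun _ _ => (n : R)⁻¹

open Polynomial in
/-- Removing the averaging matrix `J` from a matrix `M` with unit row sums and unit
column sums only replaces an eigenvalue `1` by `0`: as `(M - J) J = 0`, one has
`(X - (M - J)) (X - J) = X (X - M)`. Hence a nonzero eigenvalue of `M - J` comes, next to
the eigenvalue `1`, among the eigenvalues of `M`. -/
theorem pair_le_roots_charpoly {n : ℕ} (hn : 0 < n) {M : Matrix (Fin n) (Fin n) ℂ}
    (hrow : M * avgMatrix ℂ n = avgMatrix ℂ n) {z : ℂ} (hz : z ≠ 0)
    (h : (M - avgMatrix ℂ n).charpoly.IsRoot z) : {z, 1} ≤ M.charpoly.roots := by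
  set J := avgMatrix ℂ n with hJ
  have hn' : (n : ℂ) ≠ 0 := by exact_mod_cast hn.ne'
  have hJJ : J * J = J := by
    ext i j
    simp [Matrix.mul_apply, hJ, avgMatrix, hn']
  have key : (M - J).charmatrix * J.charmatrix = (X : ℂ[X]) • M.charmatrix := by
    have hm : (M - J).map (C : ℂ →+* ℂ[X]) * J.map (C : ℂ →+* ℂ[X]) = 0 := by
      rw [← Matrix.map_mul, sub_mul, hrow, hJJ, sub_self]
      simp
    have hs : (M - J).map (C : ℂ →+* ℂ[X]) = M.map C - J.map C := by
      ext i j : 2; simp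
    simp only [Matrix.charmatrix, RingHom.mapMatrix_apply]
    rw [sub_mul, mul_sub, mul_sub, hm, sub_zero, hs]
    have h1 : ∀ N : Matrix (Fin n) (Fin n) ℂ[X], Matrix.scalar (Fin n) (X : ℂ[X]) * N =
        (X : ℂ[X]) • N := by
      intro N; ext i j : 2; simp [Matrix.scalar_apply]
    have h2 : ∀ N : Matrix (Fin n) (Fin n) ℂ[X], N * Matrix.scalar (Fin n) (X : ℂ[X]) =
        (X : ℂ[X]) • N := by
      intro N; ext i j : 2; simp [Matrix.scalar_apply, mul_comm]
    rw [h1, h1, h2, ← smul_sub, ← smul_sub]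
    congr 1
    abel
  have hdet : (M - J).charpoly * J.charpoly = X ^ n * M.charpoly := by
    have := congrArg Matrix.det key
    rwa [Matrix.det_mul, Matrix.det_smul, Fintype.card_fin] at this
  have hJ1 : J.charpoly.IsRoot 1 := by
    rw [← Matrix.mem_spectrum_iff_isRoot_charpoly, ← Matrix.spectrum_toLin']
    apply Module.End.HasEigenvalue.mem_spectrum
    refine Module.End.hasEigenvalue_of_hasEigenvector (x := fun _ => 1) ⟨?_, ?_⟩
    · rw [Module.End.mem_eigenspace_iff]
      ext i
      simp [Matrix.mulVec, dotProduct, hJ, avgMatrix, hn']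
    · intro h0
      have := congrFun h0 ⟨0, hn⟩
      simp at this
  have hd : (X - C z) * (X - C 1) ∣ X ^ n * M.charpoly := by
    rw [← hdet]
    exact mul_dvd_mul (dvd_iff_isRoot.2 h) (dvd_iff_isRoot.2 hJ1)
  have hcop : IsCoprime ((X - C z) * (X - C 1)) ((X : ℂ[X]) ^ n) := by
    have hX : (X : ℂ[X]) = X - C 0 := by simp
    refine IsCoprime.pow_right (IsCoprime.mul_left ?_ ?_)
    · rw [hX]; convert! isCoprime_X_sub_C_of_isUnit_sub (R := ℂ) (a := z) (b := 0) ?_ using 1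
      · simp
      · simpa using hz
    · rw [hX]; convert! isCoprime_X_sub_C_of_isUnit_sub (R := ℂ) (a := 1) (b := 0) ?_ using 1
      · simp
      · simp
  have hd2 := hcop.dvd_of_dvd_mul_left hd
  have := Polynomial.roots.le_of_dvd (Matrix.charpoly_monic M).ne_zero hd2
  rw [roots_mul (mul_ne_zero (X_sub_C_ne_zero _) (X_sub_C_ne_zero _)), roots_X_sub_C,
    roots_X_sub_C] at this
  exact this

/-- If `c` exceeds the second largest element of a multiset, any further element `a` is at most
that element. -/
theorem le_getD_one_sort {s : Multiset ℝ} {a c : ℝ} (h : {a, c} ≤ s)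
    (hc : (s.sort (· ≥ ·)).getD 1 0 < c) : a ≤ (s.sort (· ≥ ·)).getD 1 0 := by
  have hs := s.sort_eq (r := (· ≥ ·))
  have hp := s.pairwise_sort (r := (· ≥ ·))
  have hcard := Multiset.card_le_card h
  rw [← hs] at hcard h
  generalize s.sort (· ≥ ·) = l at *
  match l with
  | [] => simp at hcard
  | [_] => simp at hcard
  | p :: q :: tl =>
    simp only [List.getD_cons_succ, List.getD_cons_zero] at hc ⊢
    -- otherwise `a` and `c` both exceed `q`, whereas only the head `p` can
    by_contra! hlt
    have h1 := Multiset.countP_le_of_le (fun y => q < y) h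
    have h2 : Multiset.countP (fun y => q < y) {a, c} = 2 := by
      have : ({a, c} : Multiset ℝ) = a ::ₘ c ::ₘ 0 := rfl
      rw [this, Multiset.countP_cons_of_pos _ hlt, Multiset.countP_cons_of_pos _ hc]
      simp
    rw [h2, Multiset.coe_countP, List.countP_cons, List.countP_cons] at h1
    have h3 : List.countP (fun y => decide (q < y)) tl = 0 := by
      rw [List.countP_eq_zero]
      intro y hy
      have := (List.pairwise_cons.1 (List.pairwise_cons.1 hp).2).1 y hy
      simpa using this
    rw [h3] at h1
    simp only [lt_self_iff_false, decide_false] at h1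
    split_ifs at h1 <;> simp_all

theorem secondEigenvalue_nonneg {n : ℕ} (P : Matrix (Fin n) (Fin n) ℝ) :
    0 ≤ secondEigenvalue P := by
  unfold secondEigenvalue
  rw [List.getD_eq_getElem?_getD]
  rcases h : ((((P.map (algebraMap ℝ ℂ)).charpoly.roots.map fun z => ‖z‖).sort (· ≥ ·)))[1]?
    with _ | y
  · simp
  · have := List.mem_of_getElem? h
    rw [Multiset.mem_sort, Multiset.mem_map] at this
    obtain ⟨w, -, rfl⟩ := this
    simp

open scoped Matrix.Norms.L2Operator in
/-- For a normal matrix, `P - J` is normal, so that its operator norm is its spectral radius. -/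
theorem contractsMeanZero_secondEigenvalue {n : ℕ} (hn : 2 ≤ n)
    {P : Matrix (Fin n) (Fin n) ℝ} (hP : P ∈ doublyStochastic ℝ (Fin n))
    (hN : P * P.transpose = P.transpose * P)
    (h1 : secondEigenvalue P < 1) : ContractsMeanZero P (secondEigenvalue P) := by
  have hn0 : 0 < n := by omega
  set M := P.map (algebraMap ℝ ℂ) with hM
  set J := avgMatrix ℂ n with hJ
  have hrow : M * J = J := by
    ext i j
    have := sum_row_of_mem_doublyStochastic hP i
    have h2 : ∑ j, (P i j : ℂ) = 1 := by exact_mod_cast this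
    simp [Matrix.mul_apply, hJ, avgMatrix, hM, ← Finset.sum_mul, h2]
  have hcol : J * M = J := by
    ext i j
    have := sum_col_of_mem_doublyStochastic hP j
    have h2 : ∑ i, (P i j : ℂ) = 1 := by exact_mod_cast this
    simp [Matrix.mul_apply, hJ, avgMatrix, hM, ← Finset.mul_sum, h2]
  have hJs : star J = J := by
    ext i j
    simp [Matrix.star_apply, hJ, avgMatrix]
  have hMs : star M = P.transpose.map (algebraMap ℝ ℂ) := by
    ext i j
    simp [Matrix.star_apply, hM]
  have hMN : star M * M = M * star M := by
    rw [hMs, hM, ← Matrix.map_mul, ← Matrix.map_mul, hN]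
  have hrow' : J * star M = J := by
    have := congrArg star hrow
    rwa [star_mul, hJs] at this
  have hcol' : star M * J = J := by
    have := congrArg star hcol
    rwa [star_mul, hJs] at this
  have hnorm : IsStarNormal (M - J) := by
    constructor
    change star (M - J) * (M - J) = (M - J) * star (M - J)
    rw [star_sub, hJs]
    simp only [sub_mul, mul_sub, hMN, hrow, hcol, hrow', hcol']
  have hσ0 := secondEigenvalue_nonneg P
  have hspec : ∀ z ∈ spectrum ℂ (M - J), ‖z‖ ≤ secondEigenvalue P := by
    intro z hz
    rcases eq_or_ne z 0 with rfl | hz0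
    · simpa using hσ0
    · rw [Matrix.mem_spectrum_iff_isRoot_charpoly] at hz
      have h2 := Multiset.map_le_map (f := fun z : ℂ => ‖z‖)
        (pair_le_roots_charpoly hn0 hrow hz0 hz)
      refine le_getD_one_sort (c := 1) ?_ h1
      simpa only [Multiset.insert_eq_cons, Multiset.map_cons, Multiset.map_singleton, norm_one]
        using h2
  have hop : ‖M - J‖ ≤ secondEigenvalue P := by
    have h2 := IsStarNormal.spectralRadius_eq_nnnorm (M - J)
    have h3 : spectralRadius ℂ (M - J) ≤ ENNReal.ofNNReal ⟨secondEigenvalue P, hσ0⟩ := by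
      unfold spectralRadius
      refine iSup₂_le fun z hz => ?_
      exact ENNReal.coe_le_coe.2 (hspec z hz)
    rw [h2] at h3
    exact ENNReal.coe_le_coe.1 h3
  -- `J` kills the vectors of mean zero
  intro x hx
  have h4 := (M - J).l2_opNorm_mulVec (WithLp.toLp 2 fun i => (x i : ℂ))
  have h5 : (M - J).mulVec (fun i => (x i : ℂ)) = fun i => ((P.mulVec x i : ℝ) : ℂ) := by
    ext i
    have h6 : ∑ i, (x i : ℂ) = 0 := by exact_mod_cast hx
    rw [Matrix.sub_mulVec]
    simp [Matrix.mulVec, dotProduct, hJ, avgMatrix, hM, ← Finset.mul_sum, h6]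
  have h6 : ‖(WithLp.toLp 2 fun i => ((P.mulVec x i : ℝ) : ℂ) : EuclideanSpace ℂ (Fin n))‖
      ≤ secondEigenvalue P * ‖(WithLp.toLp 2 fun i => (x i : ℂ) : EuclideanSpace ℂ (Fin n))‖ := by
    refine le_trans ?_ (mul_le_mul_of_nonneg_right hop (norm_nonneg _))
    rw [← h5]
    exact h4
  have h7 := pow_le_pow_left₀ (norm_nonneg _) h6 2
  rw [mul_pow, EuclideanSpace.norm_sq_eq, EuclideanSpace.norm_sq_eq] at h7
  simpa using h7

theorem secondSingularValue_nonneg {n : ℕ} (P : Matrix (Fin n) (Fin n) ℝ) :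
    0 ≤ secondSingularValue P :=
  LinearMap.singularValues_nonneg _ 1

theorem ContractsMeanZero.pow {n : ℕ} {P : Matrix (Fin n) (Fin n) ℝ} {σ : ℝ}
    (h : ContractsMeanZero P σ) (hP : P ∈ doublyStochastic ℝ (Fin n)) (k : ℕ) :
    ContractsMeanZero (P ^ k) (σ ^ k) := by
  induction k with
  | zero => intro x _; simp
  | succ k ih =>
    intro x hx
    have h1 : (P ^ (k + 1)).mulVec x = P.mulVec ((P ^ k).mulVec x) := by
      rw [pow_succ', Matrix.mulVec_mulVec]
    rw [h1]
    refine (h _ ?_).trans ?_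
    · rw [sum_mulVec_of_mem_doublyStochastic (pow_mem hP k), hx]
    · calc σ ^ 2 * ∑ i, (P ^ k).mulVec x i ^ 2 ≤ σ ^ 2 * ((σ ^ k) ^ 2 * ∑ i, x i ^ 2) :=
            mul_le_mul_of_nonneg_left (ih x hx) (sq_nonneg _)
        _ = _ := by ring

/-- The `ℓ₁` distance of the `v`-th row of a matrix to the uniform distribution. -/
noncomputable def rowDist {n : ℕ} (Q : Matrix (Fin n) (Fin n) ℝ) (v : Fin n) : ℝ :=
  ∑ w, |Q v w - (n : ℝ)⁻¹|

theorem rowDist_le_two {n : ℕ} {Q : Matrix (Fin n) (Fin n) ℝ}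
    (hQ : Q ∈ doublyStochastic ℝ (Fin n)) (v : Fin n) : rowDist Q v ≤ 2 := by
  have hn : (n : ℝ) ≠ 0 := by exact_mod_cast (Fin.pos v).ne'
  calc rowDist Q v ≤ ∑ w, (Q v w + (n : ℝ)⁻¹) := by
        refine Finset.sum_le_sum fun w _ => (abs_sub _ _).trans ?_
        rw [abs_of_nonneg (nonneg_of_mem_doublyStochastic hQ), abs_of_nonneg (by positivity)]
    _ = 2 := by
        rw [Finset.sum_add_distrib, sum_row_of_mem_doublyStochastic hQ]
        simp [hn]; norm_num

/-- The distance is the value at `v` of `Q` applied to a vector of signs with its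
mean removed. -/
theorem ContractsMeanZero.rowDist_le {n : ℕ} {Q : Matrix (Fin n) (Fin n) ℝ} {σ : ℝ}
    (h : ContractsMeanZero Q σ) (hσ : 0 ≤ σ) (hQ : Q ∈ doublyStochastic ℝ (Fin n)) (v : Fin n) :
    rowDist Q v ≤ √n * σ := by
  have hn : (n : ℝ) ≠ 0 := by exact_mod_cast (Fin.pos v).ne'
  set s : Fin n → ℝ := fun w => SignType.sign (Q v w - (n : ℝ)⁻¹) with hs
  set a : ℝ := (n : ℝ)⁻¹ * ∑ w, s w with ha
  have hna : ∑ w, s w = n * a := by rw [ha]; field_simp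
  have h0 : ∑ i, (s i - a) = 0 := by
    rw [Finset.sum_sub_distrib, hna]; simp
  have h1 : rowDist Q v = Q.mulVec (fun i => s i - a) v := by
    have h2 : Q.mulVec (fun i => s i - a) v = ∑ w, Q v w * s w - a := by
      simp only [Matrix.mulVec, dotProduct, mul_sub, Finset.sum_sub_distrib, ← Finset.sum_mul]
      rw [sum_row_of_mem_doublyStochastic hQ, one_mul]
    rw [h2, ha, Finset.mul_sum, ← Finset.sum_sub_distrib]
    refine Finset.sum_congr rfl fun w _ => ?_
    rw [← sub_mul]
    rw [mul_comm]
    exact (sign_mul_self _).symm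
  have h3 : ∑ i, (s i - a) ^ 2 ≤ n := by
    have h4 : ∑ i, (s i - a) ^ 2 = ∑ i, s i ^ 2 - n * a ^ 2 := by
      have : ∀ i, (s i - a) ^ 2 = s i ^ 2 - 2 * a * s i + a ^ 2 := fun i => by ring
      simp only [this, Finset.sum_add_distrib, Finset.sum_sub_distrib, ← Finset.mul_sum, hna]
      simp; ring
    have h5 : ∑ i, s i ^ 2 ≤ ∑ _i : Fin n, (1 : ℝ) := by
      refine Finset.sum_le_sum fun i _ => ?_
      simp only [hs]
      rcases SignType.trichotomy (SignType.sign (Q v i - (n : ℝ)⁻¹)) with h | h | h <;>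
        rw [h] <;> simp
    have : 0 ≤ (n : ℝ) * a ^ 2 := by positivity
    simp at h5
    linarith
  have h6 : rowDist Q v ^ 2 ≤ (√n * σ) ^ 2 := by
    rw [h1, mul_pow, Real.sq_sqrt (Nat.cast_nonneg n)]
    calc Q.mulVec (fun i => s i - a) v ^ 2 ≤ ∑ i, Q.mulVec (fun i => s i - a) i ^ 2 :=
          Finset.single_le_sum (f := fun i => Q.mulVec (fun i => s i - a) i ^ 2)
            (fun i _ => sq_nonneg _) (Finset.mem_univ v)
      _ ≤ σ ^ 2 * ∑ i, (s i - a) ^ 2 := h _ h0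
      _ ≤ σ ^ 2 * n := mul_le_mul_of_nonneg_left h3 (sq_nonneg _)
      _ = n * σ ^ 2 := mul_comm _ _
  exact le_of_sq_le_sq h6 (by positivity)

/-- The first `log (t √n) / (1 - σ)` powers are bounded trivially by `2`. After these,
`√n σ ^ k ≤ 1 / t`. -/
theorem sum_rowDist_pow_le {n : ℕ} {P : Matrix (Fin n) (Fin n) ℝ} {σ : ℝ}
    (h : ContractsMeanZero P σ) (hP : P ∈ doublyStochastic ℝ (Fin n)) (hσ : 0 ≤ σ) (hσ1 : σ < 1)
    (v : Fin n) {s t : ℕ} (ht : 1 ≤ t) (hst : s < t) :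
    ∑ k ∈ Finset.range s, rowDist (P ^ (k + 1)) v
      ≤ 2 * (Real.log (t * √n) / (1 - σ)) + 1 := by
  set A := Real.log (t * √n) / (1 - σ) with hA
  have hn : (1 : ℝ) ≤ n := by exact_mod_cast Fin.pos v
  have hn' : 1 ≤ √(n : ℝ) := by rwa [Real.one_le_sqrt]
  have ht' : (1 : ℝ) ≤ t := by exact_mod_cast ht
  have hA0 : 0 ≤ A := div_nonneg (Real.log_nonneg (by nlinarith)) (by linarith)
  have hk : ∀ k : ℕ, rowDist (P ^ (k + 1)) v ≤ (if (k + 1 : ℝ) ≤ A then 2 else 0) + 1 / t := by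
    intro k
    have hpos : (0 : ℝ) ≤ 1 / t := by positivity
    split_ifs with hkA
    · linarith [rowDist_le_two (pow_mem hP (k + 1)) v]
    · push Not at hkA
      have h1 := (h.pow hP (k + 1)).rowDist_le (by positivity) (pow_mem hP (k + 1)) v
      have h2 : σ ^ (k + 1) ≤ Real.exp (-((1 - σ) * (k + 1 : ℝ))) := by
        have : σ ≤ Real.exp (-(1 - σ)) := by
          have := Real.add_one_le_exp (-(1 - σ))
          linarith
        calc σ ^ (k + 1) ≤ Real.exp (-(1 - σ)) ^ (k + 1) := pow_le_pow_left₀ hσ this _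
          _ = _ := by
            rw [← Real.exp_nat_mul]; congr 1; push_cast; ring
      have h3 : Real.exp (-((1 - σ) * (k + 1 : ℝ))) ≤ (t * √n)⁻¹ := by
        rw [← Real.exp_log (show (0 : ℝ) < t * √n by positivity), ← Real.exp_neg]
        refine Real.exp_le_exp.2 (neg_le_neg ?_)
        rw [hA, div_lt_iff₀ (by linarith)] at hkA
        linarith
      calc rowDist (P ^ (k + 1)) v ≤ √n * σ ^ (k + 1) := h1
        _ ≤ √n * (t * √n)⁻¹ := mul_le_mul_of_nonneg_left (h2.trans h3) (by positivity)
        _ = 0 + 1 / t := by field_simp; simp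
  calc ∑ k ∈ Finset.range s, rowDist (P ^ (k + 1)) v
      ≤ ∑ k ∈ Finset.range s, ((if (k + 1 : ℝ) ≤ A then (2 : ℝ) else 0) + 1 / (t : ℝ)) :=
        Finset.sum_le_sum fun k _ => hk k
    _ = 2 * ((Finset.range s).filter fun k : ℕ => (k + 1 : ℝ) ≤ A).card + s * (1 / t) := by
        rw [Finset.sum_add_distrib, ← Finset.sum_filter]
        simp [mul_comm]
    _ ≤ 2 * A + 1 := by
        have h1 : ((Finset.range s).filter fun k : ℕ => (k + 1 : ℝ) ≤ A).card ≤ ⌊A⌋₊ := by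
          rw [← Finset.card_range ⌊A⌋₊]
          refine Finset.card_le_card fun k hk => ?_
          rw [Finset.mem_filter] at hk
          rw [Finset.mem_range]
          have : k + 1 ≤ ⌊A⌋₊ := Nat.le_floor (by exact_mod_cast hk.2)
          omega
        have h2 : ((Finset.range s).filter fun k : ℕ => (k + 1 : ℝ) ≤ A).card ≤ A :=
          (Nat.cast_le.2 h1).trans (Nat.floor_le hA0)
        have h3 : (s : ℝ) * (1 / t) ≤ 1 := by
          rw [mul_one_div, div_le_one (by positivity)]
          exact_mod_cast hst.le
        linarith

/-! ### Pathwise bounds on the iterates -/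

theorem IsSubgradientAt.norm_le {d : ℕ} {f : Model d → ℝ} {u x : Model d} {L : NNReal}
    (h : IsSubgradientAt f u x) (hf : LipschitzWith L f) : ‖u‖ ≤ L := by
  have h1 := h (x + u)
  have h2 := hf.dist_le_mul (x + u) x
  rw [add_sub_cancel_left, real_inner_self_eq_norm_sq] at h1
  rw [dist_eq_norm, Real.norm_eq_abs, dist_eq_norm, add_sub_cancel_left] at h2
  have h3 := le_abs_self (f (x + u) - f x)
  rcases (norm_nonneg u).eq_or_lt with h0 | h0
  · rw [← h0]; exact L.2
  · refine le_of_mul_le_mul_right ?_ h0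
    nlinarith

/-- Stochastic rows keep a common bound on the norm of the averaged vectors, and one gradient
step increases the squared norm by at most `η² L² + 2 η (B - C)`, as
`-⟪∂ℓ(x, z), x⟫ ≤ ℓ(0, z) - ℓ(x, z) ≤ B - C`. -/
theorem norm_iterate_le {d n m : ℕ} {𝓩 : Type*} {P : Matrix (Fin n) (Fin n) ℝ}
    (hP : P ∈ doublyStochastic ℝ (Fin n)) {g : Model d → 𝓩 → Model d} {η L b : ℝ} (hη : 0 ≤ η)
    (hb : 0 ≤ b) (hgL : ∀ x z, ‖g x z‖ ≤ L) (hgb : ∀ x z, -inner ℝ (g x z) x ≤ b)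
    (z : Fin n × Fin m → 𝓩) (k : ℕ → Fin n → Fin m) (s : ℕ) (v : Fin n) :
    ‖iterate P η g (fun _ => 0) z k s v‖ ≤ √(s * (η ^ 2 * L ^ 2 + 2 * η * b)) := by
  induction s generalizing v with
  | zero => simp [iterate]
  | succ s ih =>
    set c := η ^ 2 * L ^ 2 + 2 * η * b with hc
    have hc0 : 0 ≤ c := by positivity
    rw [iterate]
    have hy : ∀ w, ‖iterate P η g (fun _ => 0) z k s w -
        η • g (iterate P η g (fun _ => 0) z k s w) (z (w, k s w))‖ ≤ √((s + 1 : ℕ) * c) := by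
      intro w
      set X := iterate P η g (fun _ => 0) z k s w
      set u := g X (z (w, k s w)) with hu
      refine Real.le_sqrt_of_sq_le ?_
      have h1 : ‖X‖ ^ 2 ≤ s * c := by
        rw [← Real.sq_sqrt (show 0 ≤ s * c by positivity)]
        exact pow_le_pow_left₀ (norm_nonneg _) (ih w) 2
      have h2 : ‖u‖ ^ 2 ≤ L ^ 2 := pow_le_pow_left₀ (norm_nonneg _) (hgL _ _) 2
      have h3 : -inner ℝ u X ≤ b := hgb _ _
      rw [norm_sub_sq_real, real_inner_smul_right, norm_smul, mul_pow, Real.norm_eq_abs, sq_abs,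
        real_inner_comm]
      have h4 : η ^ 2 * ‖u‖ ^ 2 ≤ η ^ 2 * L ^ 2 := mul_le_mul_of_nonneg_left h2 (sq_nonneg _)
      have h5 : η * -inner ℝ u X ≤ η * b := mul_le_mul_of_nonneg_left h3 hη
      push_cast
      linarith
    calc _ ≤ ∑ w, P v w * √((s + 1 : ℕ) * c) := by
          refine norm_sum_le_of_le _ fun w _ => ?_
          rw [norm_smul, Real.norm_of_nonneg (nonneg_of_mem_doublyStochastic hP)]
          exact mul_le_mul_of_nonneg_left (hy w) (nonneg_of_mem_doublyStochastic hP)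
      _ = _ := by rw [← Finset.sum_mul, sum_row_of_mem_doublyStochastic hP, one_mul]

/-- The subgradient that node `w` uses to pass from `X^{s+1}` to `X^{s+2}`. -/
noncomputable def usedSubgradient {d n m : ℕ} {𝓩 : Type*} (P : Matrix (Fin n) (Fin n) ℝ) (η : ℝ)
    (g : Model d → 𝓩 → Model d) (z : Fin n × Fin m → 𝓩) (k : ℕ → Fin n → Fin m) (s : ℕ)
    (w : Fin n) : Model d :=
  g (iterate P η g (fun _ => 0) z k s w) (z (w, k s w))

/-- The mean over the nodes of the iterates. -/
noncomputable def meanIterate {d n m : ℕ} {𝓩 : Type*} (P : Matrix (Fin n) (Fin n) ℝ) (η : ℝ)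
    (g : Model d → 𝓩 → Model d) (z : Fin n × Fin m → 𝓩) (k : ℕ → Fin n → Fin m) (s : ℕ) :
    Model d :=
  (n : ℝ)⁻¹ • ∑ v, iterate P η g (fun _ => 0) z k s v

section Pathwise

variable {d n m : ℕ} {𝓩 : Type*} {P : Matrix (Fin n) (Fin n) ℝ} {g : Model d → 𝓩 → Model d}
  {η L : ℝ} (z : Fin n × Fin m → 𝓩) (k : ℕ → Fin n → Fin m)

theorem meanIterate_succ (hP : P ∈ doublyStochastic ℝ (Fin n)) (s : ℕ) :
    meanIterate P η g z k (s + 1) = meanIterate P η g z k s -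
      η • (n : ℝ)⁻¹ • ∑ w, usedSubgradient P η g z k s w := by
  unfold meanIterate
  simp only [iterate]
  rw [Finset.sum_comm]
  simp only [← Finset.sum_smul, sum_col_of_mem_doublyStochastic hP, one_smul,
    Finset.sum_sub_distrib, smul_sub, ← Finset.smul_sum]
  rw [smul_comm η]
  rfl

theorem iterate_eq_sum (s : ℕ) (v : Fin n) :
    iterate P η g (fun _ => 0) z k s v = -η • ∑ r ∈ Finset.range s,
      ∑ w, (P ^ (s - r)) v w • usedSubgradient P η g z k r w := by
  induction s generalizing v with
  | zero => simp [iterate]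
  | succ s ih =>
    rw [iterate, Finset.sum_range_succ]
    have h1 : ∀ r ∈ Finset.range s, ∑ w, (P ^ (s + 1 - r)) v w • usedSubgradient P η g z k r w =
        ∑ u, P v u • ∑ w, (P ^ (s - r)) u w • usedSubgradient P η g z k r w := by
      intro r hr
      rw [Finset.mem_range] at hr
      have : s + 1 - r = (s - r) + 1 := by omega
      rw [this, pow_succ']
      simp only [Matrix.mul_apply, Finset.sum_smul, Finset.smul_sum, smul_smul]
      rw [Finset.sum_comm]
    rw [Finset.sum_congr rfl h1, Finset.sum_comm]
    simp only [smul_sub, Finset.sum_sub_distrib]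
    have h2 : s + 1 - s = 1 := by omega
    rw [h2, pow_one, smul_add, sub_eq_add_neg]
    congr 1
    · rw [Finset.smul_sum]
      refine Finset.sum_congr rfl fun u _ => ?_
      rw [ih u, smul_comm, Finset.smul_sum]
    · rw [neg_smul, Finset.smul_sum]
      congr 1
      refine Finset.sum_congr rfl fun u _ => ?_
      rw [smul_comm]; rfl

theorem meanIterate_eq_sum (hP : P ∈ doublyStochastic ℝ (Fin n)) (s : ℕ) :
    meanIterate P η g z k s = -η • ∑ r ∈ Finset.range s,
      ∑ w, (n : ℝ)⁻¹ • usedSubgradient P η g z k r w := by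
  induction s with
  | zero => simp [meanIterate, iterate]
  | succ s ih =>
    rw [meanIterate_succ z k hP, ih, Finset.sum_range_succ, smul_add, sub_eq_add_neg, neg_smul,
      neg_smul, Finset.smul_sum (r := (n : ℝ)⁻¹)]

/-- The subgradients used up to now reach node `v` with the weights of a power of `P` and
reach the mean with weights `1 / n`. -/
theorem norm_iterate_sub_meanIterate_le (hP : P ∈ doublyStochastic ℝ (Fin n)) (hη : 0 ≤ η)
    (hgL : ∀ x z, ‖g x z‖ ≤ L) (s : ℕ) (v : Fin n) :
    ‖iterate P η g (fun _ => 0) z k s v - meanIterate P η g z k s‖ ≤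
      η * L * ∑ i ∈ Finset.range s, rowDist (P ^ (i + 1)) v := by
  rw [iterate_eq_sum, meanIterate_eq_sum z k hP, ← smul_sub, norm_smul, norm_neg,
    Real.norm_of_nonneg hη, mul_assoc]
  refine mul_le_mul_of_nonneg_left ?_ hη
  rw [← Finset.sum_sub_distrib, ← Finset.sum_range_reflect, Finset.mul_sum]
  refine norm_sum_le_of_le _ fun r hr => ?_
  rw [Finset.mem_range] at hr
  have h1 : s - (s - 1 - r) = r + 1 := by omega
  rw [h1, ← Finset.sum_sub_distrib, rowDist, Finset.mul_sum]
  refine norm_sum_le_of_le _ fun w _ => ?_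
  rw [← sub_smul, norm_smul, Real.norm_eq_abs, mul_comm]
  exact mul_le_mul_of_nonneg_right (hgL _ _) (abs_nonneg _)

/-- The subgradient descent inequality for the mean of the iterates, perturbed by the deviation
`δ` of the iterates from their mean, and summed over the first `t` steps. -/
theorem sum_inner_usedSubgradient_le (hP : P ∈ doublyStochastic ℝ (Fin n)) (hn : 0 < n)
    (hη : 0 < η) (hgL : ∀ x z, ‖g x z‖ ≤ L) (x : Model d) {δ : ℝ} (t : ℕ)
    (hδ : ∀ s < t, ∀ w,
      ‖iterate P η g (fun _ => 0) z k s w - meanIterate P η g z k s‖ ≤ δ) :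
    ∑ s ∈ Finset.range t, (n : ℝ)⁻¹ * ∑ w, inner ℝ (usedSubgradient P η g z k s w)
        (iterate P η g (fun _ => 0) z k s w - x) ≤
      ‖x‖ ^ 2 / (2 * η) + t * (η * L ^ 2 / 2 + L * δ) := by
  have hn' : (n : ℝ) ≠ 0 := by exact_mod_cast hn.ne'
  have hL : 0 ≤ L := (norm_nonneg _).trans (hgL 0 (z (⟨0, hn⟩, k 0 ⟨0, hn⟩)))
  set M := meanIterate P η g z k with hM
  have step : ∀ s < t, (n : ℝ)⁻¹ * ∑ w, inner ℝ (usedSubgradient P η g z k s w)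
        (iterate P η g (fun _ => 0) z k s w - x) ≤
      (‖M s - x‖ ^ 2 - ‖M (s + 1) - x‖ ^ 2) / (2 * η) + (η * L ^ 2 / 2 + L * δ) := by
    intro s hs
    set u := (n : ℝ)⁻¹ • ∑ w, usedSubgradient P η g z k s w with hu
    have h1 : (n : ℝ)⁻¹ * ∑ w, inner ℝ (usedSubgradient P η g z k s w)
        (iterate P η g (fun _ => 0) z k s w - x) = inner ℝ u (M s - x) +
        (n : ℝ)⁻¹ * ∑ w, inner ℝ (usedSubgradient P η g z k s w)
        (iterate P η g (fun _ => 0) z k s w - M s) := by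
      rw [hu, real_inner_smul_left, sum_inner, ← mul_add, ← Finset.sum_add_distrib]
      congr 1
      refine Finset.sum_congr rfl fun w _ => ?_
      rw [← inner_add_right]
      congr 1
      abel
    have hmean : ∀ {f : Fin n → ℝ} {c : ℝ}, (∀ w, f w ≤ c) → (n : ℝ)⁻¹ * ∑ w, f w ≤ c := by
      intro f c hf
      calc (n : ℝ)⁻¹ * ∑ w, f w ≤ (n : ℝ)⁻¹ * ∑ _w : Fin n, c :=
            mul_le_mul_of_nonneg_left (Finset.sum_le_sum fun w _ => hf w) (by positivity)
        _ = c := by simp; field_simp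
    have h2 : (n : ℝ)⁻¹ * ∑ w, inner ℝ (usedSubgradient P η g z k s w)
        (iterate P η g (fun _ => 0) z k s w - M s) ≤ L * δ :=
      hmean fun w => (real_inner_le_norm _ _).trans
        (mul_le_mul (hgL _ _) (hδ s hs w) (norm_nonneg _) hL)
    have h3 : ‖u‖ ≤ L := by
      rw [hu, norm_smul, norm_inv, Real.norm_natCast]
      refine le_trans ?_ (hmean fun w => hgL (iterate P η g (fun _ => 0) z k s w) (z (w, k s w)))
      exact mul_le_mul_of_nonneg_left (norm_sum_le _ _) (by positivity)
    have h4 : M (s + 1) - x = (M s - x) - η • u := by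
      rw [hM, meanIterate_succ z k hP]
      abel
    have h5 : ‖M (s + 1) - x‖ ^ 2 = ‖M s - x‖ ^ 2 - 2 * η * inner ℝ u (M s - x)
        + η ^ 2 * ‖u‖ ^ 2 := by
      rw [h4, norm_sub_sq_real, real_inner_smul_right, norm_smul, mul_pow, Real.norm_eq_abs,
        sq_abs, real_inner_comm]
      ring
    have h6 : ‖u‖ ^ 2 ≤ L ^ 2 := pow_le_pow_left₀ (norm_nonneg _) h3 2
    have h7 : inner ℝ u (M s - x) ≤ (‖M s - x‖ ^ 2 - ‖M (s + 1) - x‖ ^ 2) / (2 * η)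
        + η * L ^ 2 / 2 := by
      rw [h5]
      have : (‖M s - x‖ ^ 2 - (‖M s - x‖ ^ 2 - 2 * η * inner ℝ u (M s - x) + η ^ 2 * ‖u‖ ^ 2))
          / (2 * η) = inner ℝ u (M s - x) - η * ‖u‖ ^ 2 / 2 := by
        field_simp; ring
      rw [this]
      have := mul_le_mul_of_nonneg_left h6 hη.le
      linarith
    linarith
  calc _ ≤ ∑ s ∈ Finset.range t, ((‖M s - x‖ ^ 2 - ‖M (s + 1) - x‖ ^ 2) / (2 * η)
        + (η * L ^ 2 / 2 + L * δ)) :=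
        Finset.sum_le_sum fun s hs => step s (Finset.mem_range.1 hs)
    _ = (‖M 0 - x‖ ^ 2 - ‖M t - x‖ ^ 2) / (2 * η) + t * (η * L ^ 2 / 2 + L * δ) := by
        rw [Finset.sum_add_distrib, ← Finset.sum_div,
          Finset.sum_range_sub' (fun s => ‖M s - x‖ ^ 2)]
        simp
        ring
    _ ≤ _ := by
        have hM0 : M 0 = 0 := by simp [hM, meanIterate, iterate]
        rw [hM0, zero_sub, norm_neg]
        gcongr
        linarith [sq_nonneg ‖M t - x‖]

end Pathwise

/-! ### Optimization error in expectation over the sampled indices -/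

section Indices

variable {n m : ℕ} {Ω : Type*} [MeasurableSpace Ω] {μ : Measure Ω} [IsProbabilityMeasure μ]
  {K : ℕ → Fin n → Ω → Fin m}

/-- A function of the first `s` index vectors takes finitely many values. -/
theorem integrable_of_dependsOn (hK_meas : ∀ s v, Measurable (K s v))
    {f : (ℕ → Fin n → Fin m) → ℝ} {s : ℕ} (hf : DependsOn f (Finset.range s : Set ℕ)) :
    Integrable (fun ω => f fun s w => K s w ω) μ := by
  obtain ⟨F, rfl⟩ := dependsOn_iff_exists_comp.1 hf
  have hm : Measurable fun (ω : Ω) (i : (Finset.range s : Set ℕ)) (w : Fin n) => K i w ω :=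
    measurable_pi_lambda _ fun i => measurable_pi_lambda _ fun w => hK_meas i w
  exact (Integrable.of_finite (μ := μ.map _) (f := F)).comp_measurable hm

/-- Conditionally on the first `s` index vectors, the index of node `w` in the next one is
uniform. -/
theorem integral_apply_index (hK_meas : ∀ s v, Measurable (K s v))
    (hK_unif : ∀ s v j, μ.real (K s v ⁻¹' {j}) = 1 / (m : ℝ))
    (hK_indep : iIndepFun (fun s ω v => K s v ω) μ)
    {f : (ℕ → Fin n → Fin m) → Fin m → ℝ} {s : ℕ}
    (hf : ∀ j, DependsOn (fun k => f k j) (Finset.range s : Set ℕ)) (w : Fin n) :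
    ∫ ω, f (fun s w => K s w ω) (K s w ω) ∂μ =
      ∫ ω, (m : ℝ)⁻¹ * ∑ j, f (fun s w => K s w ω) j ∂μ := by
  have hKv : ∀ s, Measurable fun ω v => K s v ω := fun s =>
    measurable_pi_lambda _ fun w => hK_meas s w
  have hint : ∀ j, Integrable (fun ω => f (fun s w => K s w ω) j) μ := fun j =>
    integrable_of_dependsOn hK_meas (hf j)
  have hind : ∀ j, IndepFun (fun ω => if K s w ω = j then (1 : ℝ) else 0)
      (fun ω => f (fun s w => K s w ω) j) μ := by
    intro j
    obtain ⟨F, hF⟩ := dependsOn_iff_exists_comp.1 (hf j)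
    have h1 := hK_indep.indepFun_finset {s} (Finset.range s) (by simp) hKv
    have h2 := h1.comp (φ := fun p => if p ⟨s, by simp⟩ w = j then (1 : ℝ) else 0) (ψ := F)
      (measurable_of_finite _) (measurable_of_finite _)
    convert! h2 using 1
    funext ω
    exact congrFun hF _
  have hmeas : ∀ j, Measurable fun ω => if K s w ω = j then (1 : ℝ) else 0 := fun j =>
    (measurable_of_finite fun i : Fin m => if i = j then (1 : ℝ) else 0).comp (hK_meas s w)
  have hprob : ∀ j, ∫ ω, (if K s w ω = j then (1 : ℝ) else 0) ∂μ = (m : ℝ)⁻¹ := by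
    intro j
    rw [← one_div, ← hK_unif s w j,
      ← integral_indicator_one (hK_meas s w (measurableSet_singleton j))]
    refine integral_congr_ae (Filter.Eventually.of_forall fun ω => ?_)
    by_cases h : K s w ω = j
    · rw [Set.indicator_of_mem (show ω ∈ K s w ⁻¹' {j} from h)]; simp [h]
    · rw [Set.indicator_of_notMem (show ω ∉ K s w ⁻¹' {j} from h)]; simp [h]
  have hint2 : ∀ j, Integrable (fun ω => (if K s w ω = j then (1 : ℝ) else 0) *
      f (fun s w => K s w ω) j) μ := fun j =>
    (hint j).bdd_mul (c := 1) (hmeas j).aestronglyMeasurable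
      (Filter.Eventually.of_forall fun ω => by split_ifs <;> simp)
  calc ∫ ω, f (fun s w => K s w ω) (K s w ω) ∂μ
      = ∫ ω, ∑ j, (if K s w ω = j then (1 : ℝ) else 0) * f (fun s w => K s w ω) j ∂μ := by
        simp
    _ = ∑ j, (m : ℝ)⁻¹ * ∫ ω, f (fun s w => K s w ω) j ∂μ := by
        rw [integral_finsetSum _ fun j _ => hint2 j]
        refine Finset.sum_congr rfl fun j _ => ?_
        rw [(hind j).integral_fun_mul_eq_mul_integral (hmeas j).aestronglyMeasurable
          (hint j).aestronglyMeasurable, hprob]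
    _ = _ := by
        rw [integral_const_mul, integral_finsetSum _ fun j _ => hint j, Finset.mul_sum]

end Indices

theorem dependsOn_iterate {d n m : ℕ} {𝓩 : Type*} (P : Matrix (Fin n) (Fin n) ℝ) (η : ℝ)
    (g : Model d → 𝓩 → Model d) (x₁ : Fin n → Model d) (z : Fin n × Fin m → 𝓩) (s : ℕ)
    (v : Fin n) :
    DependsOn (fun k => iterate P η g x₁ z k s v) (Finset.range s : Set ℕ) := by
  induction s generalizing v with
  | zero => intro k k' _; rfl
  | succ s ih =>
    intro k k' h
    have h1 : ∀ w, iterate P η g x₁ z k s w = iterate P η g x₁ z k' s w := fun w =>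
      ih w fun i hi => h i (by simp at hi ⊢; omega)
    have h2 : k s = k' s := h s (by simp)
    simp only [iterate, h1, h2]

theorem dependsOn_iterate_of_le {d n m : ℕ} {𝓩 : Type*} (P : Matrix (Fin n) (Fin n) ℝ) (η : ℝ)
    (g : Model d → 𝓩 → Model d) (x₁ : Fin n → Model d) (z : Fin n × Fin m → 𝓩) {s t : ℕ}
    (h : s ≤ t) (v : Fin n) :
    DependsOn (fun k => iterate P η g x₁ z k s v) (Finset.range t : Set ℕ) :=
  fun _ _ hk => dependsOn_iterate P η g x₁ z s v fun i hi => hk i (by simp at hi ⊢; omega)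

theorem dependsOn_ergodicAverage {d n m : ℕ} {𝓩 : Type*} (P : Matrix (Fin n) (Fin n) ℝ) (η : ℝ)
    (g : Model d → 𝓩 → Model d) (x₁ : Fin n → Model d) (z : Fin n × Fin m → 𝓩) (t : ℕ)
    (v : Fin n) :
    DependsOn (fun k => ergodicAverage P η g x₁ z k t v) (Finset.range t : Set ℕ) := by
  intro k k' h
  simp only [ergodicAverage]
  congr 1
  exact Finset.sum_congr rfl fun s hs =>
    dependsOn_iterate_of_le P η g x₁ z (Finset.mem_range.1 hs).le v h

theorem convexOn_empiricalRisk {d n m : ℕ} {𝓩 : Type*} {ℓ : Model d → 𝓩 → ℝ}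
    (hℓ : ∀ z, ConvexOn ℝ Set.univ fun x => ℓ x z) (z : Fin n × Fin m → 𝓩) :
    ConvexOn ℝ Set.univ (empiricalRisk ℓ z) := by
  have h : ∀ S : Finset (Fin n × Fin m), ConvexOn ℝ Set.univ fun x => ∑ p ∈ S, ℓ x (z p) := by
    intro S
    induction S using Finset.induction_on with
    | empty => simpa using convexOn_const (0 : ℝ) convex_univ
    | insert a S ha ih =>
      simp only [Finset.sum_insert ha]
      exact (hℓ (z a)).add ih
  exact (h Finset.univ).smul (show (0 : ℝ) ≤ ((n : ℝ) * m)⁻¹ by positivity)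

theorem empiricalRisk_ergodicAverage_le {d n m : ℕ} {𝓩 : Type*} {ℓ : Model d → 𝓩 → ℝ}
    (hℓ : ∀ z, ConvexOn ℝ Set.univ fun x => ℓ x z) (P : Matrix (Fin n) (Fin n) ℝ) (η : ℝ)
    (g : Model d → 𝓩 → Model d) (x₁ : Fin n → Model d) (z : Fin n × Fin m → 𝓩)
    (k : ℕ → Fin n → Fin m) {t : ℕ} (ht : 1 ≤ t) (v : Fin n) :
    empiricalRisk ℓ z (ergodicAverage P η g x₁ z k t v) ≤
      (t : ℝ)⁻¹ * ∑ s ∈ Finset.range t, empiricalRisk ℓ z (iterate P η g x₁ z k s v) := by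
  have ht' : (t : ℝ) ≠ 0 := by positivity
  have := (convexOn_empiricalRisk hℓ z).map_sum_le (t := Finset.range t)
    (w := fun _ => (t : ℝ)⁻¹) (p := fun s => iterate P η g x₁ z k s v)
    (fun _ _ => by positivity) (by simp [ht']) (fun _ _ => Set.mem_univ _)
  simpa only [ergodicAverage, Finset.smul_sum, Finset.mul_sum, smul_eq_mul] using this

/-- Each summand of the empirical risk is linearized at the iterate of the node that owns it. Moving
from node `v` to that node costs `L` times their distance. -/
theorem empiricalRisk_sub_le {d n m : ℕ} {𝓩 : Type*} {ℓ : Model d → 𝓩 → ℝ} {L : NNReal}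
    (hℓ_lip : ∀ z, LipschitzWith L fun x => ℓ x z) {g : Model d → 𝓩 → Model d}
    (hg : ∀ x z, IsSubgradientAt (fun y => ℓ y z) (g x z) x) (hm : 0 < m) (hn : 0 < n)
    (z : Fin n × Fin m → 𝓩) {y : Model d} {X : Fin n → Model d} {ε : ℝ}
    (hε : ∀ w, ‖y - X w‖ ≤ ε) (x : Model d) :
    empiricalRisk ℓ z y - empiricalRisk ℓ z x ≤ L * ε + (n : ℝ)⁻¹ * ∑ w, ((m : ℝ)⁻¹ *
      ∑ i, inner ℝ (g (X w) (z (w, i))) (X w - x)) := by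
  have hn' : (n : ℝ) ≠ 0 := by exact_mod_cast hn.ne'
  have hm' : (m : ℝ) ≠ 0 := by exact_mod_cast hm.ne'
  have h1 : ∀ w i, ℓ y (z (w, i)) - ℓ x (z (w, i)) ≤
      L * ε + inner ℝ (g (X w) (z (w, i))) (X w - x) := by
    intro w i
    have h2 := (hℓ_lip (z (w, i))).dist_le_mul y (X w)
    rw [Real.dist_eq, dist_eq_norm] at h2
    have h3 := hg (X w) (z (w, i)) x
    simp only at h3
    rw [← neg_sub (X w) x, inner_neg_right] at h3
    have h4 := le_abs_self (ℓ y (z (w, i)) - ℓ (X w) (z (w, i)))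
    have h5 := mul_le_mul_of_nonneg_left (hε w) L.2
    have h6 : (L : ℝ) * ‖y - X w‖ ≤ L * ε := h5
    linarith
  calc empiricalRisk ℓ z y - empiricalRisk ℓ z x
      = ((n : ℝ) * m)⁻¹ * ∑ w, ∑ i, (ℓ y (z (w, i)) - ℓ x (z (w, i))) := by
        rw [empiricalRisk, empiricalRisk, ← mul_sub, ← Finset.sum_sub_distrib,
          Fintype.sum_prod_type]
    _ ≤ ((n : ℝ) * m)⁻¹ * ∑ w, ∑ i, (L * ε + inner ℝ (g (X w) (z (w, i))) (X w - x)) :=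
        mul_le_mul_of_nonneg_left
          (Finset.sum_le_sum fun w _ => Finset.sum_le_sum fun i _ => h1 w i) (by positivity)
    _ = _ := by
        simp only [Finset.sum_add_distrib, Finset.sum_const, Finset.card_univ, Fintype.card_fin,
          nsmul_eq_mul, mul_add, ← Finset.mul_sum]
        field_simp

/-- The optimization error of distributed SGD for a fixed dataset, against any comparison
point `x`, in terms of a bound `δ` on the deviation of the iterates from their mean. -/
theorem integral_empiricalRisk_ergodicAverage_le {d n m : ℕ} {𝓩 : Type*} {Ω : Type*}
    [MeasurableSpace Ω] {μ : Measure Ω} [IsProbabilityMeasure μ] (hn : 0 < n) (hm : 0 < m)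
    {P : Matrix (Fin n) (Fin n) ℝ} (hP : P ∈ doublyStochastic ℝ (Fin n))
    {ℓ : Model d → 𝓩 → ℝ} (hℓ_conv : ∀ z, ConvexOn ℝ Set.univ fun x => ℓ x z) {L : NNReal}
    (hℓ_lip : ∀ z, LipschitzWith L fun x => ℓ x z) {g : Model d → 𝓩 → Model d}
    (hg : ∀ x z, IsSubgradientAt (fun y => ℓ y z) (g x z) x)
    {K : ℕ → Fin n → Ω → Fin m} (hK_meas : ∀ s v, Measurable (K s v))
    (hK_unif : ∀ s v j, μ.real (K s v ⁻¹' {j}) = 1 / (m : ℝ))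
    (hK_indep : iIndepFun (fun s ω v => K s v ω) μ)
    {η : ℝ} (hη : 0 < η) (v : Fin n) {t : ℕ} (ht : 1 ≤ t) (z : Fin n × Fin m → 𝓩) {δ : ℝ}
    (hδ : ∀ k, ∀ s < t, ∀ w,
      ‖iterate P η g (fun _ => 0) z k s w - meanIterate P η g z k s‖ ≤ δ) (x : Model d) :
    ∫ ω, empiricalRisk ℓ z (ergodicAverage P η g (fun _ => 0) z (fun s w => K s w ω) t v) ∂μ ≤
      empiricalRisk ℓ z x + (η * L ^ 2 / 2 + 3 * L * δ) + ‖x‖ ^ 2 / (2 * η * t) := by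
  have ht' : (0 : ℝ) < t := by exact_mod_cast ht
  have hgL : ∀ x z, ‖g x z‖ ≤ L := fun x z => (hg x z).norm_le (hℓ_lip z)
  set k : Ω → ℕ → Fin n → Fin m := fun ω s w => K s w ω with hk
  set X := iterate P η g (fun _ => 0) z with hX
  set a : ℕ → Fin n → (ℕ → Fin n → Fin m) → Fin m → ℝ := fun s w k i =>
    inner ℝ (g (X k s w) (z (w, i))) (X k s w - x) with ha
  have hadep : ∀ s w i, DependsOn (fun k => a s w k i) (Finset.range s : Set ℕ) := by
    intro s w i k k' h
    have := dependsOn_iterate P η g (fun _ => 0) z s w h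
    simp only at this
    simp only [ha, hX, this]
  have hadep' : ∀ s w, DependsOn (fun k => a s w k (k s w)) (Finset.range (s + 1) : Set ℕ) := by
    intro s w k k' h
    have := dependsOn_iterate_of_le P η g (fun _ => 0) z (Nat.le_succ s) w h
    simp only at this
    simp only [ha, hX, this, h s (by simp)]
  have hint_avg : ∀ s w, Integrable (fun ω => (m : ℝ)⁻¹ * ∑ i, a s w (k ω) i) μ := fun s w =>
    (integrable_finsetSum _ fun i _ => integrable_of_dependsOn hK_meas (hadep s w i)).const_mul _
  have hint : ∀ s w, Integrable (fun ω => a s w (k ω) (K s w ω)) μ := fun s w =>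
    integrable_of_dependsOn hK_meas (hadep' s w)
  -- averaging over the data points of each node, pathwise
  have h1 : ∀ ω, empiricalRisk ℓ z (ergodicAverage P η g (fun _ => 0) z (k ω) t v) ≤
      empiricalRisk ℓ z x + 2 * L * δ + (t : ℝ)⁻¹ * ∑ s ∈ Finset.range t, (n : ℝ)⁻¹ *
        ∑ w, (m : ℝ)⁻¹ * ∑ i, a s w (k ω) i := by
    intro ω
    refine (empiricalRisk_ergodicAverage_le hℓ_conv P η g _ z (k ω) ht v).trans ?_
    have h2 : ∀ s ∈ Finset.range t, empiricalRisk ℓ z (X (k ω) s v) ≤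
        (empiricalRisk ℓ z x + 2 * L * δ) + (n : ℝ)⁻¹ * ∑ w, (m : ℝ)⁻¹ * ∑ i, a s w (k ω) i := by
      intro s hs
      have h3 : ∀ w, ‖X (k ω) s v - X (k ω) s w‖ ≤ 2 * δ := by
        intro w
        have h4 := hδ (k ω) s (Finset.mem_range.1 hs)
        have h5 : X (k ω) s v - X (k ω) s w = (X (k ω) s v - meanIterate P η g z (k ω) s) -
          (X (k ω) s w - meanIterate P η g z (k ω) s) := by abel
        rw [h5]
        refine (norm_sub_le _ _).trans ?_
        linarith [h4 v, h4 w]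
      have := empiricalRisk_sub_le hℓ_lip hg hm hn z h3 x
      simp only [ha]
      linarith
    calc (t : ℝ)⁻¹ * ∑ s ∈ Finset.range t, empiricalRisk ℓ z (X (k ω) s v)
        ≤ (t : ℝ)⁻¹ * ∑ s ∈ Finset.range t, ((empiricalRisk ℓ z x + 2 * L * δ) +
          (n : ℝ)⁻¹ * ∑ w, (m : ℝ)⁻¹ * ∑ i, a s w (k ω) i) :=
          mul_le_mul_of_nonneg_left (Finset.sum_le_sum h2) (by positivity)
      _ = _ := by
          rw [Finset.sum_add_distrib, mul_add]
          congr 1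
          rw [Finset.sum_const, Finset.card_range, nsmul_eq_mul, inv_mul_cancel_left₀ ht'.ne']
  -- the descent inequality, pathwise
  have h2 : ∀ ω, (t : ℝ)⁻¹ * ∑ s ∈ Finset.range t, (n : ℝ)⁻¹ * ∑ w, a s w (k ω) (K s w ω) ≤
      ‖x‖ ^ 2 / (2 * η * t) + (η * L ^ 2 / 2 + L * δ) := by
    intro ω
    have h3 := sum_inner_usedSubgradient_le z (k ω) hP hn hη hgL x t (hδ (k ω))
    calc _ ≤ (t : ℝ)⁻¹ * (‖x‖ ^ 2 / (2 * η) + t * (η * L ^ 2 / 2 + L * δ)) :=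
          mul_le_mul_of_nonneg_left h3 (by positivity)
      _ = _ := by field_simp
  have hI1 : Integrable (fun ω => (t : ℝ)⁻¹ * ∑ s ∈ Finset.range t, (n : ℝ)⁻¹ *
      ∑ w, (m : ℝ)⁻¹ * ∑ i, a s w (k ω) i) μ :=
    (integrable_finsetSum _ fun s _ =>
      (integrable_finsetSum _ fun w _ => hint_avg s w).const_mul _).const_mul _
  have hI2 : Integrable (fun ω => (t : ℝ)⁻¹ * ∑ s ∈ Finset.range t, (n : ℝ)⁻¹ *
      ∑ w, a s w (k ω) (K s w ω)) μ :=
    (integrable_finsetSum _ fun s _ =>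
      (integrable_finsetSum _ fun w _ => hint s w).const_mul _).const_mul _
  have hI3 : Integrable (fun ω => empiricalRisk ℓ z
      (ergodicAverage P η g (fun _ => 0) z (k ω) t v)) μ := by
    refine integrable_of_dependsOn (f := fun k => empiricalRisk ℓ z
      (ergodicAverage P η g (fun _ => 0) z k t v)) (s := t) hK_meas fun k k' h => ?_
    have := dependsOn_ergodicAverage P η g (fun _ => 0) z t v h
    simp only at this
    simp only [this]
  have hEq : ∫ ω, (t : ℝ)⁻¹ * ∑ s ∈ Finset.range t, (n : ℝ)⁻¹ *
      ∑ w, (m : ℝ)⁻¹ * ∑ i, a s w (k ω) i ∂μ =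
      ∫ ω, (t : ℝ)⁻¹ * ∑ s ∈ Finset.range t, (n : ℝ)⁻¹ * ∑ w, a s w (k ω) (K s w ω) ∂μ := by
    rw [integral_const_mul, integral_const_mul,
      integral_finsetSum _ fun s _ => (integrable_finsetSum _ fun w _ => hint_avg s w).const_mul _,
      integral_finsetSum _ fun s _ => (integrable_finsetSum _ fun w _ => hint s w).const_mul _]
    congr 1
    refine Finset.sum_congr rfl fun s _ => ?_
    rw [integral_const_mul, integral_const_mul, integral_finsetSum _ fun w _ => hint_avg s w,
      integral_finsetSum _ fun w _ => hint s w]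
    congr 1
    exact Finset.sum_congr rfl fun w _ =>
      (integral_apply_index hK_meas hK_unif hK_indep (hadep s w) w).symm
  calc _ ≤ ∫ ω, (empiricalRisk ℓ z x + 2 * L * δ + (t : ℝ)⁻¹ * ∑ s ∈ Finset.range t,
        (n : ℝ)⁻¹ * ∑ w, (m : ℝ)⁻¹ * ∑ i, a s w (k ω) i) ∂μ :=
        integral_mono hI3 ((integrable_const _).add hI1) h1
    _ = empiricalRisk ℓ z x + 2 * L * δ + ∫ ω, (t : ℝ)⁻¹ * ∑ s ∈ Finset.range t, (n : ℝ)⁻¹ *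
        ∑ w, a s w (k ω) (K s w ω) ∂μ := by
        rw [integral_add (integrable_const _) hI1, hEq]
        simp
    _ ≤ empiricalRisk ℓ z x + 2 * L * δ +
        ∫ _ω, (‖x‖ ^ 2 / (2 * η * t) + (η * L ^ 2 / 2 + L * δ)) ∂μ :=
        add_le_add le_rfl (integral_mono hI2 (integrable_const _) h2)
    _ = _ := by simp; ring

/-- The factor `3` comes from the passage between the mean, node `v` and the node that owns the data
point. For `t ≥ 2` the constants are absorbed by `log (t √n) ≥ 1`, and for `t = 1` all iterates
agree, so that only `η L² / 2` has to be absorbed. -/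
theorem consensus_constant_le {n t : ℕ} (hn : 2 ≤ n) (ht : 1 ≤ t) {η L σ : ℝ} (hη : 0 ≤ η)
    (hσ : 0 ≤ σ) (hσ1 : σ < 1) {δ : ℝ} (hδ0 : t = 1 → δ ≤ 0) (hL : 0 ≤ L)
    (hδ : δ ≤ η * L * (2 * (Real.log (t * √n) / (1 - σ)) + 1)) :
    η * L ^ 2 / 2 + 3 * L * δ ≤ 19 / 2 * (η * L ^ 2 * Real.log (t * √n) / (1 - σ)) := by
  set ll := Real.log (t * √n) with hll
  have hA : ll ≤ ll / (1 - σ) ∨ ll < 0 := by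
    by_cases h : 0 ≤ ll
    · left; rw [le_div_iff₀ (by linarith)]; nlinarith
    · right; linarith
  have hn' : (2 : ℝ) ≤ n := by exact_mod_cast hn
  have ht' : (0 : ℝ) < t := by exact_mod_cast ht
  have hlog : ll = Real.log t + Real.log n / 2 := by
    rw [hll, Real.log_mul (by positivity) (by positivity), Real.log_sqrt (by positivity)]
  have h2 := Real.log_two_gt_d9
  have hln : Real.log 2 ≤ Real.log n := Real.log_le_log (by norm_num) hn'
  have hηL : 0 ≤ η * L ^ 2 := by positivity
  have hmain : η * L ^ 2 * ll / (1 - σ) = η * L ^ 2 * (ll / (1 - σ)) := by ring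
  rw [hmain]
  rcases Nat.eq_or_lt_of_le ht with h1 | h1
  · have h3 : 3 * L * δ ≤ 0 := mul_nonpos_of_nonneg_of_nonpos (by positivity) (hδ0 h1.symm)
    rw [← h1] at hlog
    simp at hlog
    have h4 : 1 / 19 ≤ ll / (1 - σ) := by
      rcases hA with h | h <;> linarith
    nlinarith
  · have h3 : Real.log 2 ≤ Real.log t := Real.log_le_log (by norm_num) (by exact_mod_cast h1)
    have h4 : 1 ≤ ll / (1 - σ) := by
      rcases hA with h | h <;> linarith
    have h5 : 3 * L * δ ≤ 3 * L * (η * L * (2 * (ll / (1 - σ)) + 1)) :=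
      mul_le_mul_of_nonneg_left hδ (by positivity)
    nlinarith [mul_le_mul_of_nonneg_left h4 hηL]

/-! ### Symmetrization -/

section Symmetrization

variable {ι 𝓩 : Type*} [Fintype ι] {f : ℕ → 𝓩 → ℝ} {b : ℝ}

/-- The supremum over `k` of the empirical mean of `f k`, with the signs `σ`. -/
noncomputable def signedSup (f : ℕ → 𝓩 → ℝ) (σ : ι → ℤˣ) (z : ι → 𝓩) : ℝ :=
  ⨆ k, (Fintype.card ι : ℝ)⁻¹ * ∑ i, ((σ i : ℤ) : ℝ) * f k (z i)

/-- The same supremum for the differences between two samples. -/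
noncomputable def signedSupDiff (f : ℕ → 𝓩 → ℝ) (σ : ι → ℤˣ) (p : (ι → 𝓩) × (ι → 𝓩)) : ℝ :=
  ⨆ k, (Fintype.card ι : ℝ)⁻¹ * ∑ i, ((σ i : ℤ) : ℝ) * (f k (p.2 i) - f k (p.1 i))

theorem abs_average_le [Nonempty ι] {a : ι → ℝ} {c : ℝ} (h : ∀ i, |a i| ≤ c) :
    |(Fintype.card ι : ℝ)⁻¹ * ∑ i, a i| ≤ c := by
  have hN : (Fintype.card ι : ℝ) ≠ 0 := by exact_mod_cast Fintype.card_ne_zero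
  rw [abs_mul, abs_inv, Nat.abs_cast]
  calc _ ≤ (Fintype.card ι : ℝ)⁻¹ * ∑ _i : ι, c :=
        mul_le_mul_of_nonneg_left
          ((Finset.abs_sum_le_sum_abs _ _).trans (Finset.sum_le_sum fun i _ => h i)) (by positivity)
    _ = c := by simp [hN]

theorem abs_iSup_le {a : ℕ → ℝ} {c : ℝ} (h : ∀ k, |a k| ≤ c) : |⨆ k, a k| ≤ c := by
  refine abs_le.2 ⟨?_, ciSup_le fun k => (abs_le.1 (h k)).2⟩
  exact (abs_le.1 (h 0)).1.trans (le_ciSup ⟨c, by rintro _ ⟨k, rfl⟩; exact (abs_le.1 (h k)).2⟩ 0)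

theorem bddAbove_of_abs_le {a : ℕ → ℝ} {c : ℝ} (h : ∀ k, |a k| ≤ c) :
    BddAbove (Set.range a) :=
  ⟨c, by rintro _ ⟨k, rfl⟩; exact (abs_le.1 (h k)).2⟩

theorem abs_sign_mul (s : ℤˣ) (a : ℝ) : |((s : ℤ) : ℝ) * a| = |a| := by
  rcases Int.units_eq_one_or s with rfl | rfl <;> simp

theorem abs_signedTerm_le [Nonempty ι] (hb : ∀ k z, |f k z| ≤ b) (σ : ι → ℤˣ) (z : ι → 𝓩)
    (k : ℕ) : |(Fintype.card ι : ℝ)⁻¹ * ∑ i, ((σ i : ℤ) : ℝ) * f k (z i)| ≤ b :=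
  abs_average_le fun i => by rw [abs_sign_mul]; exact hb _ _

theorem abs_signedDiffTerm_le [Nonempty ι] (hb : ∀ k z, |f k z| ≤ b) (σ : ι → ℤˣ)
    (p : (ι → 𝓩) × (ι → 𝓩)) (k : ℕ) :
    |(Fintype.card ι : ℝ)⁻¹ * ∑ i, ((σ i : ℤ) : ℝ) * (f k (p.2 i) - f k (p.1 i))| ≤ 2 * b :=
  abs_average_le fun i => by
    rw [abs_sign_mul]
    refine (abs_sub _ _).trans ?_
    linarith [hb k (p.2 i), hb k (p.1 i)]

theorem signedSupDiff_le [Nonempty ι] (hb : ∀ k z, |f k z| ≤ b) (σ : ι → ℤˣ)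
    (p : (ι → 𝓩) × (ι → 𝓩)) :
    signedSupDiff f σ p ≤ signedSup f σ p.2 + signedSup f (-σ) p.1 := by
  refine ciSup_le fun k => ?_
  have h1 := le_ciSup (bddAbove_of_abs_le fun k => abs_signedTerm_le hb σ p.2 k) k
  have h2 := le_ciSup (bddAbove_of_abs_le fun k => abs_signedTerm_le hb (-σ) p.1 k) k
  refine le_trans (le_of_eq ?_) (add_le_add h1 h2)
  rw [← mul_add, ← Finset.sum_add_distrib]
  congr 1
  refine Finset.sum_congr rfl fun i _ => ?_
  simp
  ring

variable [MeasurableSpace 𝓩] {ν : Measure 𝓩} [IsProbabilityMeasure ν]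

theorem measurable_signedSupDiff (hf : ∀ k, Measurable (f k)) (σ : ι → ℤˣ) :
    Measurable (signedSupDiff f σ) := by
  unfold signedSupDiff
  refine Measurable.iSup fun k => ?_
  have := hf k
  fun_prop

theorem integrable_of_abs_le {α : Type*} [MeasurableSpace α] {μ : Measure α} [IsFiniteMeasure μ]
    {h : α → ℝ} (hm : Measurable h) {c : ℝ} (hc : ∀ a, |h a| ≤ c) : Integrable h μ :=
  Integrable.of_bound hm.aestronglyMeasurable c (Filter.Eventually.of_forall hc)

theorem integrable_signedSupDiff [Nonempty ι] (hf : ∀ k, Measurable (f k))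
    (hb : ∀ k z, |f k z| ≤ b) (σ : ι → ℤˣ) (π : Measure ((ι → 𝓩) × (ι → 𝓩)))
    [IsFiniteMeasure π] : Integrable (signedSupDiff f σ) π :=
  integrable_of_abs_le (measurable_signedSupDiff hf σ)
    fun p => abs_iSup_le (abs_signedDiffTerm_le hb σ p)

/-- Exchanging the `i`-th points of the two samples preserves their joint law and changes the `i`-th
sign. -/
theorem integral_signedSupDiff_eq (hf : ∀ k, Measurable (f k)) (σ : ι → ℤˣ) :
    ∫ p, signedSupDiff f σ p ∂((Measure.pi fun _ : ι => ν).prod (Measure.pi fun _ : ι => ν)) =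
      ∫ p, signedSupDiff f 1 p ∂((Measure.pi fun _ : ι => ν).prod (Measure.pi fun _ : ι => ν)) := by
  have he := measurePreserving_arrowProdEquivProdArrow 𝓩 𝓩 ι (fun _ => ν) (fun _ => ν)
  have hswap : MeasurePreserving (fun (q : ι → 𝓩 × 𝓩) i => if σ i = 1 then q i else (q i).swap)
      (Measure.pi fun _ : ι => ν.prod ν) (Measure.pi fun _ : ι => ν.prod ν) := by
    refine measurePreserving_pi (fun _ => ν.prod ν) (fun _ => ν.prod ν)
      (f := fun i q => if σ i = 1 then q else q.swap) fun i => ?_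
    by_cases h : σ i = 1
    · simp only [h, if_true]; exact MeasurePreserving.id _
    · simp only [h, if_false]; exact Measure.measurePreserving_swap
  have hms := fun τ : ι → ℤˣ => (measurable_signedSupDiff hf τ).aestronglyMeasurable
    (μ := (Measure.pi fun _ : ι => ν).prod (Measure.pi fun _ : ι => ν))
  rw [← he.map_eq, integral_map he.measurable.aemeasurable (he.map_eq ▸ hms σ),
    integral_map he.measurable.aemeasurable (he.map_eq ▸ hms 1)]
  conv_rhs => rw [← hswap.map_eq]
  have hcomp : Measurable fun q =>
      signedSupDiff f 1 (MeasurableEquiv.arrowProdEquivProdArrow 𝓩 𝓩 ι q) :=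
    (measurable_signedSupDiff hf 1).comp he.measurable
  rw [integral_map hswap.measurable.aemeasurable hcomp.aestronglyMeasurable]
  refine integral_congr_ae (Filter.Eventually.of_forall fun q => ?_)
  simp only [signedSupDiff]
  congr 1
  funext k
  congr 1
  refine Finset.sum_congr rfl fun i _ => ?_
  rcases Int.units_eq_one_or (σ i) with h | h <;>
    simp [h, MeasurableEquiv.arrowProdEquivProdArrow, Equiv.arrowProdEquivProdArrow]

/-- Symmetrization, with an independent second sample that represents the expectations. -/
theorem integral_iSup_sub_average_le [Nonempty ι] [DecidableEq ι] (hf : ∀ k, Measurable (f k))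
    (hb : ∀ k z, |f k z| ≤ b) {c : ℝ}
    (hc : ∀ z : ι → 𝓩, (Fintype.card (ι → ℤˣ) : ℝ)⁻¹ * ∑ σ : ι → ℤˣ, signedSup f σ z ≤ c) :
    ∫ z, (⨆ k, (∫ y, f k y ∂ν - (Fintype.card ι : ℝ)⁻¹ * ∑ i, f k (z i)))
      ∂(Measure.pi fun _ : ι => ν) ≤ 2 * c := by
  set π := Measure.pi fun _ : ι => ν with hπ
  have hN : (Fintype.card ι : ℝ) ≠ 0 := by exact_mod_cast Fintype.card_ne_zero
  have heval : ∀ k i, Integrable (fun z : ι → 𝓩 => f k (z i)) π := fun k i =>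
    integrable_of_abs_le ((hf k).comp (measurable_pi_apply i)) fun z => hb k (z i)
  have hmean : ∀ k, ∫ y, f k y ∂ν = ∫ z', (Fintype.card ι : ℝ)⁻¹ * ∑ i, f k (z' i) ∂π := by
    intro k
    have h1 : ∀ i, ∫ z' : ι → 𝓩, f k (z' i) ∂π = ∫ y, f k y ∂ν := by
      intro i
      have h2 := measurePreserving_eval (fun _ : ι => ν) i
      conv_rhs => rw [← h2.map_eq]
      rw [integral_map h2.measurable.aemeasurable (hf k).aestronglyMeasurable]
    rw [integral_const_mul, integral_finsetSum _ fun i _ => heval k i]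
    simp [h1, hN]
  have hΨ := fun σ : ι → ℤˣ => integrable_signedSupDiff hf hb σ (π.prod π)
  have hmeanb : ∀ k, |∫ y, f k y ∂ν| ≤ b := fun k => by
    have := norm_integral_le_of_norm_le_const (μ := ν) (f := f k) (C := b)
      (Filter.Eventually.of_forall fun y => hb k y)
    simpa using this
  have hΦterm : ∀ (z : ι → 𝓩) k,
      |∫ y, f k y ∂ν - (Fintype.card ι : ℝ)⁻¹ * ∑ i, f k (z i)| ≤ 2 * b := fun z k => by
    refine (abs_sub _ _).trans ?_
    have := abs_average_le fun i => hb k (z i)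
    linarith [hmeanb k]
  have hΦ : Integrable (fun z : ι → 𝓩 =>
      ⨆ k, (∫ y, f k y ∂ν - (Fintype.card ι : ℝ)⁻¹ * ∑ i, f k (z i))) π := by
    refine integrable_of_abs_le (Measurable.iSup fun k => ?_) fun z => abs_iSup_le (hΦterm z)
    have := hf k
    fun_prop
  have h1 : ∀ z, (⨆ k, (∫ y, f k y ∂ν - (Fintype.card ι : ℝ)⁻¹ * ∑ i, f k (z i))) ≤
      ∫ z', signedSupDiff f 1 (z, z') ∂π := by
    intro z
    refine ciSup_le fun k => ?_
    have h2 : Integrable (fun z' => signedSupDiff f 1 (z, z')) π :=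
      integrable_of_abs_le ((measurable_signedSupDiff hf 1).comp measurable_prodMk_left)
        fun z' => abs_iSup_le (abs_signedDiffTerm_le hb 1 (z, z'))
    have h3 : Integrable (fun z' : ι → 𝓩 => (Fintype.card ι : ℝ)⁻¹ * ∑ i, f k (z' i)) π :=
      (integrable_finsetSum _ fun i _ => heval k i).const_mul _
    have h4 : ∫ y, f k y ∂ν - (Fintype.card ι : ℝ)⁻¹ * ∑ i, f k (z i) =
        ∫ z', ((Fintype.card ι : ℝ)⁻¹ * ∑ i, f k (z' i) -
          (Fintype.card ι : ℝ)⁻¹ * ∑ i, f k (z i)) ∂π := by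
      rw [integral_sub h3 (integrable_const _), hmean k]
      simp
    rw [h4]
    refine integral_mono (h3.sub (integrable_const _)) h2 fun z' => ?_
    refine le_trans (le_of_eq ?_)
      (le_ciSup (bddAbove_of_abs_le (abs_signedDiffTerm_le hb 1 (z, z'))) k)
    simp [mul_sub]
  have h2 : ∀ p : (ι → 𝓩) × (ι → 𝓩),
      (Fintype.card (ι → ℤˣ) : ℝ)⁻¹ * ∑ σ, signedSupDiff f σ p ≤ 2 * c := by
    intro p
    have h3 : ∑ σ, signedSup f (-σ) p.1 = ∑ σ, signedSup f σ p.1 :=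
      Equiv.sum_comp (Equiv.neg (ι → ℤˣ)) fun σ => signedSup f σ p.1
    calc _ ≤ (Fintype.card (ι → ℤˣ) : ℝ)⁻¹ *
          ∑ σ, (signedSup f σ p.2 + signedSup f (-σ) p.1) :=
          mul_le_mul_of_nonneg_left (Finset.sum_le_sum fun σ _ => signedSupDiff_le hb σ p)
            (by positivity)
      _ ≤ _ := by
          rw [Finset.sum_add_distrib, h3, mul_add, two_mul]
          exact add_le_add (hc p.2) (hc p.1)
  have hS : (Fintype.card (ι → ℤˣ) : ℝ) ≠ 0 := by exact_mod_cast Fintype.card_ne_zero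
  calc _ ≤ ∫ z, ∫ z', signedSupDiff f 1 (z, z') ∂π ∂π :=
        integral_mono hΦ (hΨ 1).integral_prod_left h1
    _ = ∫ p, signedSupDiff f 1 p ∂(π.prod π) := (integral_prod _ (hΨ 1)).symm
    _ = (Fintype.card (ι → ℤˣ) : ℝ)⁻¹ * ∑ σ : ι → ℤˣ, ∫ p, signedSupDiff f σ p ∂(π.prod π) := by
        simp only [hπ, integral_signedSupDiff_eq hf]
        rw [Finset.sum_const, Finset.card_univ, nsmul_eq_mul, inv_mul_cancel_left₀ hS]
    _ = ∫ p, (Fintype.card (ι → ℤˣ) : ℝ)⁻¹ * ∑ σ, signedSupDiff f σ p ∂(π.prod π) := by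
        rw [integral_const_mul, integral_finsetSum _ fun σ _ => hΨ σ]
    _ ≤ ∫ _p, 2 * c ∂(π.prod π) :=
        integral_mono ((integrable_finsetSum _ fun σ _ => hΨ σ).const_mul _) (integrable_const _) h2
    _ = 2 * c := by simp

end Symmetrization

/-! ### Generalization error -/

section Generalization

variable {d : ℕ} {𝓩 : Type*} {ℓ : Model d → 𝓩 → ℝ} {L : NNReal} {B C : ℝ}

theorem abs_loss_le (hℓ_lip : ∀ z, LipschitzWith L fun x => ℓ x z) (hB : ∀ z, ℓ 0 z ≤ B)
    (hC : ∀ x z, C ≤ ℓ x z) {ρ : ℝ} {x : Model d} (hx : ‖x‖ ≤ ρ) (z : 𝓩) :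
    |ℓ x z| ≤ |B| + |C| + L * ρ := by
  have h1 := (hℓ_lip z).dist_le_mul x 0
  rw [Real.dist_eq, dist_zero_right] at h1
  have h2 := le_abs_self (ℓ x z - ℓ 0 z)
  have h3 : (L : ℝ) * ‖x‖ ≤ L * ρ := mul_le_mul_of_nonneg_left hx L.2
  have h4 : (0 : ℝ) ≤ L * ‖x‖ := mul_nonneg L.2 (norm_nonneg x)
  have := hB z
  have := hC x z
  refine abs_le.2 ⟨?_, ?_⟩
  · linarith [neg_abs_le C, abs_nonneg B]
  · linarith [le_abs_self B, abs_nonneg C]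

theorem abs_empiricalRisk_le {n m : ℕ} [Nonempty (Fin n × Fin m)]
    (hℓ_lip : ∀ z, LipschitzWith L fun x => ℓ x z) (hB : ∀ z, ℓ 0 z ≤ B)
    (hC : ∀ x z, C ≤ ℓ x z) {ρ : ℝ} {x : Model d} (hx : ‖x‖ ≤ ρ) (z : Fin n × Fin m → 𝓩) :
    |empiricalRisk ℓ z x| ≤ |B| + |C| + L * ρ := by
  have := abs_average_le fun p => abs_loss_le hℓ_lip hB hC hx (z p)
  simpa [empiricalRisk] using this

theorem continuous_empiricalRisk {n m : ℕ} (hℓ_lip : ∀ z, LipschitzWith L fun x => ℓ x z)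
    (z : Fin n × Fin m → 𝓩) : Continuous (empiricalRisk ℓ z) :=
  continuous_const.mul (continuous_finsetSum _ fun p _ => (hℓ_lip (z p)).continuous)

variable [MeasurableSpace 𝓩]

theorem measurable_uncurry_loss (hℓ_meas : ∀ x, Measurable (ℓ x))
    (hℓ_lip : ∀ z, LipschitzWith L fun x => ℓ x z) : Measurable (Function.uncurry ℓ) :=
  measurable_uncurry_of_continuous_of_measurable (fun z => (hℓ_lip z).continuous) hℓ_meas

theorem measurable_empiricalRisk {n m : ℕ} (hℓ_meas : ∀ x, Measurable (ℓ x))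
    (hℓ_lip : ∀ z, LipschitzWith L fun x => ℓ x z) :
    Measurable fun p : (Fin n × Fin m → 𝓩) × Model d => empiricalRisk ℓ p.1 p.2 := by
  unfold empiricalRisk
  refine (Finset.measurable_sum _ fun q _ => ?_).const_mul _
  exact (measurable_uncurry_loss hℓ_meas hℓ_lip).comp
    (measurable_snd.prodMk ((measurable_pi_apply q).comp measurable_fst))

variable (ν : Measure 𝓩) [IsProbabilityMeasure ν]

theorem integrable_loss (hℓ_meas : ∀ x, Measurable (ℓ x))
    (hℓ_lip : ∀ z, LipschitzWith L fun x => ℓ x z) (hB : ∀ z, ℓ 0 z ≤ B)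
    (hC : ∀ x z, C ≤ ℓ x z) (x : Model d) : Integrable (ℓ x) ν :=
  integrable_of_abs_le (hℓ_meas x) fun z => abs_loss_le hℓ_lip hB hC le_rfl z

theorem abs_testRisk_le (hℓ_lip : ∀ z, LipschitzWith L fun x => ℓ x z) (hB : ∀ z, ℓ 0 z ≤ B)
    (hC : ∀ x z, C ≤ ℓ x z) {ρ : ℝ} {x : Model d} (hx : ‖x‖ ≤ ρ) :
    |testRisk ℓ ν x| ≤ |B| + |C| + L * ρ := by
  have := norm_integral_le_of_norm_le_const (μ := ν) (f := ℓ x) (C := |B| + |C| + L * ρ)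
    (Filter.Eventually.of_forall fun z => abs_loss_le hℓ_lip hB hC hx z)
  simpa [testRisk] using this

theorem lipschitzWith_testRisk (hℓ_meas : ∀ x, Measurable (ℓ x))
    (hℓ_lip : ∀ z, LipschitzWith L fun x => ℓ x z) (hB : ∀ z, ℓ 0 z ≤ B)
    (hC : ∀ x z, C ≤ ℓ x z) : LipschitzWith L (testRisk ℓ ν) := by
  refine LipschitzWith.of_dist_le_mul fun x y => ?_
  rw [Real.dist_eq, testRisk, testRisk, ← integral_sub (integrable_loss ν hℓ_meas hℓ_lip hB hC x)
    (integrable_loss ν hℓ_meas hℓ_lip hB hC y)]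
  have := norm_integral_le_of_norm_le_const (μ := ν) (f := fun z => ℓ x z - ℓ y z)
    (C := L * dist x y) (Filter.Eventually.of_forall fun z => (hℓ_lip z).dist_le_mul x y)
  simpa using this

/-- The Rademacher bound is applied to a countable dense subset of the ball that contains the
estimator, so that the suprema are measurable. -/
theorem integral_testRisk_sub_empiricalRisk_le {n m : ℕ} [Nonempty (Fin n × Fin m)]
    (hℓ_meas : ∀ x, Measurable (ℓ x)) (hℓ_lip : ∀ z, LipschitzWith L fun x => ℓ x z)
    (hB : ∀ z, ℓ 0 z ≤ B) (hC : ∀ x z, C ≤ ℓ x z) {D : ℝ} (hD : 0 ≤ D)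
    (hRad : RademacherBound ℓ n m D) {Ω : Type*} [MeasurableSpace Ω] {μ : Measure Ω}
    [IsProbabilityMeasure μ] {Z : Ω → Fin n × Fin m → 𝓩} (hZ : Measurable Z)
    (hZ_law : μ.map Z = Measure.pi fun _ => ν) {Y : Ω → Model d} (hY : Measurable Y) {ρ : ℝ}
    (hρ : 0 ≤ ρ) (hYρ : ∀ ω, ‖Y ω‖ ≤ ρ) :
    ∫ ω, (testRisk ℓ ν (Y ω) - empiricalRisk ℓ (Z ω) (Y ω)) ∂μ ≤
      2 * (D * ρ / √((n : ℝ) * m)) := by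
  set S : Set (Model d) := Metric.closedBall 0 ρ with hS
  have hSne : Nonempty S := ⟨⟨0, by simp [hS, hρ]⟩⟩
  set u : ℕ → Model d := fun k => TopologicalSpace.denseSeq S k with hu
  have huρ : ∀ k, ‖u k‖ ≤ ρ := fun k => by
    have h : u k ∈ S := (TopologicalSpace.denseSeq S k).2
    simpa [hS] using h
  set b := |B| + |C| + L * ρ with hb
  have hf : ∀ k, Measurable (ℓ (u k)) := fun k => hℓ_meas _
  have hfb : ∀ k z, |ℓ (u k) z| ≤ b := fun k z => abs_loss_le hℓ_lip hB hC (huρ k) z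
  have hc : ∀ z : Fin n × Fin m → 𝓩, (Fintype.card (Fin n × Fin m → ℤˣ) : ℝ)⁻¹ *
      ∑ σ, signedSup (fun k => ℓ (u k)) σ z ≤ D * ρ / √((n : ℝ) * m) := by
    intro z
    have h1 := hRad z (Set.range u) (Set.range_nonempty u)
      ((Metric.isBounded_closedBall (x := (0 : Model d)) (r := ρ)).subset (by
        rintro _ ⟨k, rfl⟩
        simpa using huρ k))
    have h2 : rademacherAverage ℓ z (Set.range u) = (Fintype.card (Fin n × Fin m → ℤˣ) : ℝ)⁻¹ *
        ∑ σ, signedSup (fun k => ℓ (u k)) σ z := by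
      rw [rademacherAverage]
      congr 1
      refine Finset.sum_congr rfl fun σ _ => ?_
      exact iSup_range' (fun x => (Fintype.card (Fin n × Fin m) : ℝ)⁻¹ *
        ∑ i, ((σ i : ℤ) : ℝ) * ℓ x (z i)) u
    rw [← h2]
    refine h1.trans ?_
    have h3 : (⨆ x : Set.range u, ‖(x : Model d)‖) ≤ ρ := by
      have : Nonempty (Set.range u) := (Set.range_nonempty u).to_subtype
      refine ciSup_le ?_
      rintro ⟨_, k, rfl⟩
      exact huρ k
    gcongr
  set Φ : (Fin n × Fin m → 𝓩) → ℝ := fun z => ⨆ k, (testRisk ℓ ν (u k) -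
    (Fintype.card (Fin n × Fin m) : ℝ)⁻¹ * ∑ i, ℓ (u k) (z i)) with hΦ
  have hsym : ∫ z, Φ z ∂(Measure.pi fun _ => ν) ≤ 2 * (D * ρ / √((n : ℝ) * m)) :=
    integral_iSup_sub_average_le hf hfb hc
  have hterm : ∀ (z : Fin n × Fin m → 𝓩) k, |testRisk ℓ ν (u k) -
      (Fintype.card (Fin n × Fin m) : ℝ)⁻¹ * ∑ i, ℓ (u k) (z i)| ≤ 2 * b := fun z k => by
    refine (abs_sub _ _).trans ?_
    have := abs_average_le fun i => hfb k (z i)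
    linarith [abs_testRisk_le ν hℓ_lip hB hC (huρ k)]
  have hΦm : Measurable Φ := by
    refine Measurable.iSup fun k => ?_
    have := hf k
    fun_prop
  have hpt : ∀ z y, ‖y‖ ≤ ρ → testRisk ℓ ν y - empiricalRisk ℓ z y ≤ Φ z := by
    intro z y hy
    have hcont : Continuous fun y : S => testRisk ℓ ν y - empiricalRisk ℓ z y :=
      ((lipschitzWith_testRisk ν hℓ_meas hℓ_lip hB hC).continuous.sub
        (continuous_empiricalRisk hℓ_lip z)).comp continuous_subtype_val
    refine isClosed_property (p := fun y : S => testRisk ℓ ν y - empiricalRisk ℓ z y ≤ Φ z)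
      (TopologicalSpace.denseRange_denseSeq S)
      (isClosed_le hcont continuous_const) (fun k => ?_) ⟨y, by simpa [hS] using hy⟩
    have := le_ciSup (bddAbove_of_abs_le (hterm z)) k
    simpa [hΦ, empiricalRisk] using this
  have hint : Integrable (fun ω => testRisk ℓ ν (Y ω) - empiricalRisk ℓ (Z ω) (Y ω)) μ := by
    refine integrable_of_abs_le (c := 2 * b) ?_ fun ω => ?_
    · exact ((lipschitzWith_testRisk ν hℓ_meas hℓ_lip hB hC).continuous.measurable.comp hY).sub
        ((measurable_empiricalRisk hℓ_meas hℓ_lip).comp (hZ.prodMk hY))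
    · refine (abs_sub _ _).trans ?_
      linarith [abs_testRisk_le ν hℓ_lip hB hC (hYρ ω),
        abs_empiricalRisk_le hℓ_lip hB hC (hYρ ω) (Z ω)]
  calc _ ≤ ∫ ω, Φ (Z ω) ∂μ := by
        refine integral_mono hint ?_ fun ω => hpt _ _ (hYρ ω)
        exact integrable_of_abs_le (hΦm.comp hZ) fun ω => abs_iSup_le (hterm (Z ω))
    _ = ∫ z, Φ z ∂(Measure.pi fun _ => ν) := by
        rw [← hZ_law, integral_map hZ.aemeasurable hΦm.aestronglyMeasurable]
    _ ≤ _ := hsym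

end Generalization

theorem measurable_iterate {d n m : ℕ} {𝓩 : Type*} [MeasurableSpace 𝓩]
    (P : Matrix (Fin n) (Fin n) ℝ) (η : ℝ) {g : Model d → 𝓩 → Model d}
    (hg : Measurable fun p : Model d × 𝓩 => g p.1 p.2) (x₁ : Fin n → Model d) (s : ℕ) (v : Fin n) :
    Measurable fun p : (Fin n × Fin m → 𝓩) × (ℕ → Fin n → Fin m) =>
      iterate P η g x₁ p.1 p.2 s v := by
  induction s generalizing v with
  | zero => exact measurable_const
  | succ s ih =>
    simp only [iterate]
    refine Finset.measurable_sum _ fun w _ => ?_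
    have h1 : Measurable fun q : (Fin n × Fin m → 𝓩) × Fin m => q.1 (w, q.2) :=
      measurable_from_prod_countable_left fun j => measurable_pi_apply (w, j)
    have h2 : Measurable fun p : (Fin n × Fin m → 𝓩) × (ℕ → Fin n → Fin m) => p.2 s w :=
      (measurable_pi_apply w).comp ((measurable_pi_apply s).comp measurable_snd)
    have h3 : Measurable fun p : (Fin n × Fin m → 𝓩) × (ℕ → Fin n → Fin m) =>
        p.1 (w, p.2 s w) := h1.comp (measurable_fst.prodMk h2)
    exact ((ih w).sub ((hg.comp ((ih w).prodMk h3)).const_smul η)).const_smul (P v w)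

theorem measurable_ergodicAverage {d n m : ℕ} {𝓩 : Type*} [MeasurableSpace 𝓩]
    (P : Matrix (Fin n) (Fin n) ℝ) (η : ℝ) {g : Model d → 𝓩 → Model d}
    (hg : Measurable fun p : Model d × 𝓩 => g p.1 p.2) (x₁ : Fin n → Model d) (t : ℕ) (v : Fin n) :
    Measurable fun p : (Fin n × Fin m → 𝓩) × (ℕ → Fin n → Fin m) =>
      ergodicAverage P η g x₁ p.1 p.2 t v := by
  unfold ergodicAverage
  exact (Finset.measurable_sum (Finset.range t) fun s _ =>
    measurable_iterate P η hg x₁ s v).const_smul (t : ℝ)⁻¹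

theorem norm_ergodicAverage_le {d n m : ℕ} {𝓩 : Type*} {P : Matrix (Fin n) (Fin n) ℝ}
    (hP : P ∈ doublyStochastic ℝ (Fin n)) {g : Model d → 𝓩 → Model d} {η L b : ℝ} (hη : 0 ≤ η)
    (hb : 0 ≤ b) (hgL : ∀ x z, ‖g x z‖ ≤ L) (hgb : ∀ x z, -inner ℝ (g x z) x ≤ b)
    (z : Fin n × Fin m → 𝓩) (k : ℕ → Fin n → Fin m) {t : ℕ} (ht : 1 ≤ t) (v : Fin n) :
    ‖ergodicAverage P η g (fun _ => 0) z k t v‖ ≤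
      √(((t : ℝ) - 1) * (η ^ 2 * L ^ 2 + 2 * η * b)) := by
  have ht' : (0 : ℝ) < t := by exact_mod_cast ht
  set ρ := √(((t : ℝ) - 1) * (η ^ 2 * L ^ 2 + 2 * η * b)) with hρ
  have h1 : ∀ s ∈ Finset.range t, ‖iterate P η g (fun _ => 0) z k s v‖ ≤ ρ := by
    intro s hs
    refine (norm_iterate_le hP hη hb hgL hgb z k s v).trans (Real.sqrt_le_sqrt ?_)
    refine mul_le_mul_of_nonneg_right ?_ (by positivity)
    have : ((s + 1 : ℕ) : ℝ) ≤ t := by exact_mod_cast Finset.mem_range.1 hs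
    push_cast at this
    linarith
  rw [ergodicAverage, norm_smul, norm_inv, Real.norm_natCast]
  calc (t : ℝ)⁻¹ * ‖∑ s ∈ Finset.range t, iterate P η g (fun _ => 0) z k s v‖
      ≤ (t : ℝ)⁻¹ * ∑ _s ∈ Finset.range t, ρ :=
        mul_le_mul_of_nonneg_left (norm_sum_le_of_le _ h1) (by positivity)
    _ = ρ := by simp [ht'.ne']

/-! ### Combination -/

/-- The hypothesis on `σ₂` enters the argument only through the contraction of mean-zero vectors. -/
theorem contractsMeanZero_of_eq {n : ℕ} (hn : 2 ≤ n) {P : Matrix (Fin n) (Fin n) ℝ}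
    (hP : P ∈ doublyStochastic ℝ (Fin n)) {σ : ℝ}
    (hσ : (P * P.transpose = P.transpose * P ∧ σ = secondEigenvalue P) ∨
      σ = secondSingularValue P) (hσ1 : σ < 1) : 0 ≤ σ ∧ ContractsMeanZero P σ := by
  rcases hσ with ⟨hN, rfl⟩ | rfl
  · exact ⟨secondEigenvalue_nonneg P, contractsMeanZero_secondEigenvalue hn hP hN hσ1⟩
  · exact ⟨secondSingularValue_nonneg P, contractsMeanZero_secondSingularValue hn hP hσ1⟩

/-- Optimization error for a fixed dataset against any comparison point `x`, with the spectral
constant. -/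
theorem integral_empiricalRisk_ergodicAverage_le_log {d n m : ℕ} {𝓩 : Type*} {Ω : Type*}
    [MeasurableSpace Ω] {μ : Measure Ω} [IsProbabilityMeasure μ] (hn : 2 ≤ n) (hm : 0 < m)
    {P : Matrix (Fin n) (Fin n) ℝ} (hP : P ∈ doublyStochastic ℝ (Fin n)) {σ : ℝ} (hσ : 0 ≤ σ)
    (hσ1 : σ < 1) (hPσ : ContractsMeanZero P σ)
    {ℓ : Model d → 𝓩 → ℝ} (hℓ_conv : ∀ z, ConvexOn ℝ Set.univ fun x => ℓ x z) {L : NNReal}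
    (hℓ_lip : ∀ z, LipschitzWith L fun x => ℓ x z) {g : Model d → 𝓩 → Model d}
    (hg : ∀ x z, IsSubgradientAt (fun y => ℓ y z) (g x z) x)
    {K : ℕ → Fin n → Ω → Fin m} (hK_meas : ∀ s v, Measurable (K s v))
    (hK_unif : ∀ s v j, μ.real (K s v ⁻¹' {j}) = 1 / (m : ℝ))
    (hK_indep : iIndepFun (fun s ω v => K s v ω) μ)
    {η : ℝ} (hη : 0 < η) (v : Fin n) {t : ℕ} (ht : 1 ≤ t) (z : Fin n × Fin m → 𝓩) (x : Model d) :
    ∫ ω, empiricalRisk ℓ z (ergodicAverage P η g (fun _ => 0) z (fun s w => K s w ω) t v) ∂μ ≤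
      empiricalRisk ℓ z x + 19 / 2 * (η * L ^ 2 * Real.log (t * √n) / (1 - σ)) +
        ‖x‖ ^ 2 / (2 * η * t) := by
  have hgL : ∀ x z, ‖g x z‖ ≤ L := fun x z => (hg x z).norm_le (hℓ_lip z)
  set c := η * L * (2 * (Real.log (t * √n) / (1 - σ)) + 1) with hc
  have hc0 : 0 ≤ c := by
    have h1 : (1 : ℝ) ≤ t := by exact_mod_cast ht
    have h2 : 1 ≤ √(n : ℝ) := by
      rw [Real.one_le_sqrt]; exact_mod_cast (by omega : 1 ≤ n)
    have h3 : 0 ≤ Real.log (t * √n) / (1 - σ) :=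
      div_nonneg (Real.log_nonneg (by nlinarith)) (by linarith)
    have := L.2
    positivity
  set δ := if t = 1 then 0 else c with hδ
  have hδc : δ ≤ c := by rw [hδ]; split_ifs <;> simp [hc0]
  have hdev : ∀ k, ∀ s < t, ∀ w,
      ‖iterate P η g (fun _ => 0) z k s w - meanIterate P η g z k s‖ ≤ δ := by
    intro k s hs w
    by_cases h : t = 1
    · have hs0 : s = 0 := by omega
      rw [hδ, if_pos h, hs0]
      simp [iterate, meanIterate]
    · rw [hδ, if_neg h]
      refine (norm_iterate_sub_meanIterate_le z k hP hη.le hgL s w).trans ?_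
      exact mul_le_mul_of_nonneg_left (sum_rowDist_pow_le hPσ hP hσ hσ1 w ht hs)
        (mul_nonneg hη.le L.2)
  have h1 := integral_empiricalRisk_ergodicAverage_le (by omega) hm hP hℓ_conv hℓ_lip hg hK_meas
    hK_unif hK_indep hη v ht z hdev x
  have h2 := consensus_constant_le hn ht hη.le hσ hσ1 (δ := δ) (fun h => by simp [hδ, h]) L.2 hδc
  have h3 : η * (L : ℝ) ^ 2 / 2 + 3 * L * δ ≤
      19 / 2 * (η * (L : ℝ) ^ 2 * Real.log (t * √n) / (1 - σ)) := h2
  linarith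

end DistSGD

theorem mainTheorem2
    {d n m : ℕ} (hn : 2 ≤ n)
    -- the graph and the doubly stochastic matrix supported on it
    (Gr : SimpleGraph (Fin n)) (P : Matrix (Fin n) (Fin n) ℝ)
    (hP : P ∈ doublyStochastic ℝ (Fin n))
    (hPGr : ∀ i j, P i j ≠ 0 → i = j ∨ Gr.Adj i j)
    (σ₂ : ℝ)
    (hσ₂ : (P * P.transpose = P.transpose * P ∧ σ₂ = DistSGD.secondEigenvalue P) ∨
      σ₂ = DistSGD.secondSingularValue P)
    (hσ₂_lt : σ₂ < 1)
    -- the loss and the chosen subgradients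
    {𝓩 : Type*} [MeasurableSpace 𝓩] (ℓ : DistSGD.Model d → 𝓩 → ℝ)
    (hℓ_meas : ∀ x, Measurable (ℓ x))
    (hℓ_conv : ∀ z, ConvexOn ℝ Set.univ (fun x => ℓ x z))
    (L : NNReal) (hℓ_lip : ∀ z, LipschitzWith L (fun x => ℓ x z))
    (B C D : ℝ) (hCB : C ≤ B) (hB : ∀ z, ℓ 0 z ≤ B) (hC : ∀ x z, C ≤ ℓ x z)
    (hD : 0 ≤ D) (hRad : DistSGD.RademacherBound ℓ n m D)
    (g : DistSGD.Model d → 𝓩 → DistSGD.Model d)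
    (hg_meas : Measurable (fun p : DistSGD.Model d × 𝓩 => g p.1 p.2))
    (hg : ∀ x z, DistSGD.IsSubgradientAt (fun y => ℓ y z) (g x z) x)
    -- the i.i.d. data with law `ν`
    {Ω : Type*} [MeasurableSpace Ω] (μ : MeasureTheory.Measure Ω)
    [MeasureTheory.IsProbabilityMeasure μ]
    (ν : MeasureTheory.Measure 𝓩) [MeasureTheory.IsProbabilityMeasure ν]
    (Z : Fin n × Fin m → Ω → 𝓩) (hZ_meas : ∀ p, Measurable (Z p))
    (hZ_law : ∀ p, μ.map (Z p) = ν) (hZ_indep : ProbabilityTheory.iIndepFun Z μ)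
    -- the sampled indices: uniform, independent over time and independent of the data
    (K : ℕ → Fin n → Ω → Fin m) (hK_meas : ∀ s v, Measurable (K s v))
    (hK_unif : ∀ s v j, μ.real (K s v ⁻¹' {j}) = 1 / (m : ℝ))
    (hK_indep : ProbabilityTheory.iIndepFun (fun s ω v => K s v ω) μ)
    (hKZ_indep : ProbabilityTheory.IndepFun (fun ω p => Z p ω) (fun ω s v => K s v ω) μ)
    -- minimisers of the test risk and of the empirical risk
    (xstar : DistSGD.Model d)
    (hxstar : ∀ x, DistSGD.testRisk ℓ ν xstar ≤ DistSGD.testRisk ℓ ν x)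
    (G : ℝ) (Xstar : Ω → DistSGD.Model d)
    (hXstar : ∀ᵐ ω ∂μ,
      (∀ x, DistSGD.empiricalRisk ℓ (fun p => Z p ω) (Xstar ω) ≤
        DistSGD.empiricalRisk ℓ (fun p => Z p ω) x) ∧ ‖Xstar ω‖ ≤ G)
    (η : ℝ) (hη : 0 < η) (v : Fin n) (t : ℕ) (ht : 1 ≤ t) :
    MeasureTheory.Integrable (fun ω => DistSGD.testRisk ℓ ν
        (DistSGD.ergodicAverage P η g (fun _ => 0) (fun p => Z p ω) (fun s w => K s w ω) t v)) μ ∧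
    (∫ ω, DistSGD.testRisk ℓ ν
        (DistSGD.ergodicAverage P η g (fun _ => 0) (fun p => Z p ω) (fun s w => K s w ω) t v) ∂μ)
        - DistSGD.testRisk ℓ ν xstar
      ≤ 2 * D * √(((t : ℝ) - 1) * (η ^ 2 * (L : ℝ) ^ 2 + 2 * η * (B - C)) / ((n : ℝ) * m))
        + 19 / 2 * (η * (L : ℝ) ^ 2 * Real.log (t * √(n : ℝ)) / (1 - σ₂))
        + G ^ 2 / (2 * η * t) := by 
  obtain ⟨ω₀⟩ := nonempty_of_isProbabilityMeasure μ
  have hm : 0 < m := Fin.pos (K 0 v ω₀)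
  have : Nonempty (Fin n × Fin m) := ⟨(v, K 0 v ω₀)⟩
  obtain ⟨hσ0, hPσ⟩ := DistSGD.contractsMeanZero_of_eq hn hP hσ₂ hσ₂_lt
  have hgL : ∀ x z, ‖g x z‖ ≤ L := fun x z => (hg x z).norm_le (hℓ_lip z)
  have hgb : ∀ x z, -inner ℝ (g x z) x ≤ B - C := by
    intro x z
    have := hg x z 0
    rw [zero_sub, inner_neg_right] at this
    linarith [hB z, hC x z]
  set ρ := √(((t : ℝ) - 1) * (η ^ 2 * (L : ℝ) ^ 2 + 2 * η * (B - C))) with hρ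
  set Zv : Ω → Fin n × Fin m → 𝓩 := fun ω p => Z p ω with hZv
  set Kv : Ω → ℕ → Fin n → Fin m := fun ω s w => K s w ω with hKv
  set avg : (Fin n × Fin m → 𝓩) × (ℕ → Fin n → Fin m) → DistSGD.Model d := fun p =>
    DistSGD.ergodicAverage P η g (fun _ => 0) p.1 p.2 t v with havg
  have hZm : Measurable Zv := measurable_pi_lambda _ hZ_meas
  have hKm : Measurable Kv := measurable_pi_lambda _ fun s => measurable_pi_lambda _ (hK_meas s)
  have havgm : Measurable avg := DistSGD.measurable_ergodicAverage P η hg_meas _ t v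
  have havgρ : ∀ p, ‖avg p‖ ≤ ρ := fun p =>
    DistSGD.norm_ergodicAverage_le hP hη.le (sub_nonneg.2 hCB) hgL hgb p.1 p.2 ht v
  have hYm : Measurable fun ω => avg (Zv ω, Kv ω) := havgm.comp (hZm.prodMk hKm)
  have hZlaw : μ.map Zv = MeasureTheory.Measure.pi fun _ => ν := by
    rw [(ProbabilityTheory.iIndepFun_iff_map_fun_eq_pi_map
      fun p => (hZ_meas p).aemeasurable).1 hZ_indep]
    simp only [hZ_law]
  have hint_r : MeasureTheory.Integrable
      (fun ω => DistSGD.testRisk ℓ ν (avg (Zv ω, Kv ω))) μ :=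
    DistSGD.integrable_of_abs_le
      ((DistSGD.lipschitzWith_testRisk ν hℓ_meas hℓ_lip hB hC).continuous.measurable.comp hYm)
      fun ω => DistSGD.abs_testRisk_le ν hℓ_lip hB hC (havgρ _)
  refine ⟨hint_r, ?_⟩
  -- the empirical risk of the output, as a function of the dataset and the indices
  set H : (Fin n × Fin m → 𝓩) × (ℕ → Fin n → Fin m) → ℝ := fun p =>
    DistSGD.empiricalRisk ℓ p.1 (avg p) with hH
  have hHm : Measurable H :=
    (DistSGD.measurable_empiricalRisk hℓ_meas hℓ_lip).comp (measurable_fst.prodMk havgm)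
  have hHb : ∀ p, |H p| ≤ |B| + |C| + L * ρ := fun p =>
    DistSGD.abs_empiricalRisk_le hℓ_lip hB hC (havgρ p) p.1
  have hint_R : MeasureTheory.Integrable (fun ω => H (Zv ω, Kv ω)) μ :=
    DistSGD.integrable_of_abs_le (hHm.comp (hZm.prodMk hKm)) fun ω => hHb _
  have hgen := DistSGD.integral_testRisk_sub_empiricalRisk_le ν hℓ_meas hℓ_lip hB hC hD hRad hZm
    hZlaw hYm (Real.sqrt_nonneg _) fun ω => havgρ (Zv ω, Kv ω)
  have hgen' : (∫ ω, DistSGD.testRisk ℓ ν (avg (Zv ω, Kv ω)) ∂μ) - ∫ ω, H (Zv ω, Kv ω) ∂μ ≤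
      2 * (D * ρ / √((n : ℝ) * m)) := by
    rw [← MeasureTheory.integral_sub hint_r hint_R]
    exact hgen
  -- the data and the indices are independent: average over the indices first
  set Φ : (Fin n × Fin m → 𝓩) → ℝ := fun z => ∫ ω, H (z, Kv ω) ∂μ with hΦ
  have hΦb : ∀ z, |Φ z| ≤ |B| + |C| + L * ρ := fun z => by
    have := MeasureTheory.norm_integral_le_of_norm_le_const (μ := μ)
      (f := fun ω => H (z, Kv ω)) (Filter.Eventually.of_forall fun ω => hHb (z, Kv ω))
    simpa [hΦ] using this
  have hΦeq : Φ = fun z => ∫ k, H (z, k) ∂(μ.map Kv) := by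
    funext z
    have hHz : Measurable fun k => H (z, k) := hHm.comp measurable_prodMk_left
    rw [MeasureTheory.integral_map hKm.aemeasurable hHz.aestronglyMeasurable]
  have hΦm : Measurable Φ := by
    rw [hΦeq]
    exact hHm.stronglyMeasurable.integral_prod_right'.measurable
  have hfub : ∫ ω, H (Zv ω, Kv ω) ∂μ = ∫ ω, Φ (Zv ω) ∂μ := by
    have h1 := (ProbabilityTheory.indepFun_iff_map_prod_eq_prod_map_map hZm.aemeasurable
      hKm.aemeasurable).1 hKZ_indep
    calc ∫ ω, H (Zv ω, Kv ω) ∂μ = ∫ p, H p ∂(μ.map fun ω => (Zv ω, Kv ω)) :=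
          (MeasureTheory.integral_map (hZm.prodMk hKm).aemeasurable
            hHm.aestronglyMeasurable).symm
      _ = ∫ z, Φ z ∂(μ.map Zv) := by
          rw [h1, hΦeq, MeasureTheory.integral_prod _
            (DistSGD.integrable_of_abs_le hHm hHb)]
      _ = _ := MeasureTheory.integral_map hZm.aemeasurable hΦm.aestronglyMeasurable
  set A := 19 / 2 * (η * (L : ℝ) ^ 2 * Real.log (t * √(n : ℝ)) / (1 - σ₂)) with hA
  -- `Xstar` need not be measurable: it is compared with `xstar` pointwise
  have hpt : ∀ᵐ ω ∂μ, Φ (Zv ω) ≤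
      DistSGD.empiricalRisk ℓ (Zv ω) xstar + (A + G ^ 2 / (2 * η * t)) := by
    filter_upwards [hXstar] with ω hω
    have h1 := DistSGD.integral_empiricalRisk_ergodicAverage_le_log hn hm hP hσ0 hσ₂_lt hPσ hℓ_conv
      hℓ_lip hg hK_meas hK_unif hK_indep hη v ht (Zv ω) (Xstar ω)
    have h2 : ‖Xstar ω‖ ^ 2 / (2 * η * t) ≤ G ^ 2 / (2 * η * t) :=
      div_le_div_of_nonneg_right (pow_le_pow_left₀ (norm_nonneg _) hω.2 2) (by positivity)
    have h3 := hω.1 xstar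
    have h4 : Φ (Zv ω) ≤ _ := h1
    linarith
  have hRint : ∀ p, MeasureTheory.Integrable (fun ω => ℓ xstar (Z p ω)) μ := fun p =>
    DistSGD.integrable_of_abs_le ((hℓ_meas xstar).comp (hZ_meas p))
      fun ω => DistSGD.abs_loss_le hℓ_lip hB hC le_rfl (Z p ω)
  have hRint' : MeasureTheory.Integrable (fun ω => DistSGD.empiricalRisk ℓ (Zv ω) xstar) μ :=
    (MeasureTheory.integrable_finsetSum _ fun p _ => hRint p).const_mul _
  have hRstar : ∫ ω, DistSGD.empiricalRisk ℓ (Zv ω) xstar ∂μ = DistSGD.testRisk ℓ ν xstar := by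
    have h1 : ∀ p, ∫ ω, ℓ xstar (Z p ω) ∂μ = DistSGD.testRisk ℓ ν xstar := by
      intro p
      rw [DistSGD.testRisk, ← hZ_law p, MeasureTheory.integral_map (hZ_meas p).aemeasurable
        (hℓ_meas xstar).aestronglyMeasurable]
    have hn' : (n : ℝ) ≠ 0 := by positivity
    have hm' : (m : ℝ) ≠ 0 := by positivity
    simp only [DistSGD.empiricalRisk, hZv]
    rw [MeasureTheory.integral_const_mul, MeasureTheory.integral_finsetSum _ fun p _ => hRint p]
    simp only [h1, Finset.sum_const, Finset.card_univ, Fintype.card_prod, Fintype.card_fin,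
      nsmul_eq_mul, Nat.cast_mul]
    field_simp
  have hopt : ∫ ω, H (Zv ω, Kv ω) ∂μ ≤
      DistSGD.testRisk ℓ ν xstar + (A + G ^ 2 / (2 * η * t)) := by
    rw [hfub, ← hRstar]
    calc _ ≤ ∫ ω, (DistSGD.empiricalRisk ℓ (Zv ω) xstar + (A + G ^ 2 / (2 * η * t))) ∂μ :=
          MeasureTheory.integral_mono_ae
            (DistSGD.integrable_of_abs_le (hΦm.comp hZm) fun ω => hΦb (Zv ω))
            (hRint'.add (MeasureTheory.integrable_const _)) hpt
      _ = _ := by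
          rw [MeasureTheory.integral_add hRint' (MeasureTheory.integrable_const _)]
          simp
  have hsqrt : √(((t : ℝ) - 1) * (η ^ 2 * (L : ℝ) ^ 2 + 2 * η * (B - C)) / ((n : ℝ) * m)) =
      ρ / √((n : ℝ) * m) := Real.sqrt_div' _ (by positivity)
  rw [hsqrt, mul_assoc, ← mul_div_assoc]
  have hgoal : (∫ ω, DistSGD.testRisk ℓ ν (avg (Zv ω, Kv ω)) ∂μ) - DistSGD.testRisk ℓ ν xstar ≤
      2 * (D * ρ / √((n : ℝ) * m)) + A + G ^ 2 / (2 * η * t) := by linarith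
  exact hgoal
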